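/- Notation. Let $\mathbb C_+$ be the upper half-plane and let $\mathcal H^2_+$ be its Hardy space, i.e. the holomorphic $F$ on $\mathbb C_+$ with $\sup_{y>0}\int_{\mathbb R}|F(x+iy)|^2\,dx<\infty$, identified through non-tangential boundary values with a closed subspace of $L^2(\mathbb R)$; $\mathcal H^\infty_+$ is the space of bounded holomorphic functions on $\mathbb C_+$. The Smirnov class $\mathcal N^+$ is the set of (boundary functions of) quotients $G/F$ with $G,F\in\mathcal H^\infty_+$ and $F$ outer, i.e. $F(z)=c\exp\Big(\frac1{\pi i}\int_{\mathbb R}\big(\frac1{t-z}-\frac t{1+t^2}\big)k(t)\,dt\Big)$ with $|c|=1$ and $k$ real-valued, $\int_{\mathbb R}\frac{|k(t)|}{1+t^2}\,dt<\infty$; $\overline{\mathcal N^+}$ is the set of complex conjugates of the boundary functions in $\mathcal N^+$. Let $b_i(z)=\frac{z-i}{z+i}$. Let $q$ be an inner function on $\mathbb C_+$ (an element of $\mathcal H^\infty_+$ with $|q|=1$ a.e. on $\mathbb R$) and let $E_2=q\mathcal H^2_+$. For $\varphi\in L^\infty(\mathbb R)$, let $T_\varphi^{\mathcal H^2_+,E_2}:\mathcal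 H^2_+\to E_2$, $T_\varphi^{\mathcal H^2_+,E_2}f=P_{E_2}(\varphi f)$, where $P_{E_2}$ is the orthogonal projection of $L^2(\mathbb R)$ onto $E_2$. For subspaces $X,Y$ of $\mathcal H^2_+$, let $\mathcal M^+(X,Y)$ be the space of holomorphic functions $\psi$ on $\mathbb C_+$ with $\psi X\subseteq Y$, and let $\mathcal M_2^+(X,Y)=\mathcal M^+(X,Y)\cap L^2(\mathbb R)$ be the subspace of those $\psi$ whose non-tangential boundary function exists a.e. and lies in $L^2(\mathbb R)$. Theorem. Let $g,g^{-1},h\in L^\infty(\mathbb R)$, and assume that the kernels $\ker T_g^{\mathcal H^2_+,E_2}$ and $\ker T_h^{\mathcal H^2_+,E_2}$ are both different from $\{0\}$. Suppose further that $\frac hg b_i\in\overline{\mathcal N^+}$. Then the following statements are equivalent: (1) $\dim\ker T_{\frac hg\overline{b_i}}^{\mathcal H^2_+,E_2}\ge 2$; (2) $\ker T_{\frac hg}^{\mathcal H^2_+,E_2}\ne\{0\}$; (3) $\mathcal M_2^+\big(\ker T_g^{\mathcal H^2_+,E_2},\ker T_h^{\mathcal H^2_+,E_2}\big)\ne\{0\}$.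 -/

import Mathlib

open MeasureTheory Filter Topology ComplexConjugate
open scoped ENNReal NNReal Manifold UpperHalfPlane

noncomputable section

namespace HalfPlane

/-- The Hilbert space `L²(ℝ)`, for Lebesgue measure. -/
abbrev L2 : Type := Lp ℂ 2 (volume : Measure ℝ)

/-! ### Boundary values -/

/-- The filter of non-tangential approach to the boundary point `x`, inside the cone with vertex `x`
and aperture `α`. -/
def coneFilter (x α : ℝ) : Filter ℍ :=
  comap (fun z : ℍ => (z : ℂ)) (𝓝[{z : ℂ | |z.re - x| < α * z.im}] (x : ℂ))

/-- `F` has the non-tangential limit `c` at the boundary point `x`. -/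
def HasNTLimit (F : ℍ → ℂ) (x : ℝ) (c : ℂ) : Prop :=
  ∀ α : ℝ, 0 < α → Tendsto F (coneFilter x α) (𝓝 c)

/-- `f` is the non-tangential boundary function of `F`, almost everywhere on `ℝ`. -/
def HasBoundaryFunction (F : ℍ → ℂ) (f : ℝ → ℂ) : Prop :=
  ∀ᵐ x : ℝ, HasNTLimit F x (f x)

theorem HasBoundaryFunction.congr {F : ℍ → ℂ} {f f' : ℝ → ℂ} (h : HasBoundaryFunction F f)
    (hf : f =ᵐ[volume] f') : HasBoundaryFunction F f' := by
  filter_upwards [h, hf] with x hx hfx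
  rwa [← hfx]

theorem HasBoundaryFunction.add {F G : ℍ → ℂ} {f g : ℝ → ℂ} (hF : HasBoundaryFunction F f)
    (hG : HasBoundaryFunction G g) : HasBoundaryFunction (F + G) (f + g) := by
  filter_upwards [hF, hG] with x hx hy α hα
  exact (hx α hα).add (hy α hα)

theorem HasBoundaryFunction.smul {F : ℍ → ℂ} {f : ℝ → ℂ} (c : ℂ)
    (hF : HasBoundaryFunction F f) : HasBoundaryFunction (c • F) (c • f) := by
  filter_upwards [hF] with x hx α hα
  exact (hx α hα).const_smul c

theorem hasBoundaryFunction_zero : HasBoundaryFunction 0 0 :=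
  Eventually.of_forall fun _ _ _ => tendsto_const_nhds

/-- The boundary functions in `L²(ℝ)` of the members of a space of functions on the upper
half-plane. -/
def boundarySpace (V : Submodule ℂ (ℍ → ℂ)) : Submodule ℂ L2 where
  carrier := {f | ∃ F ∈ V, HasBoundaryFunction F f}
  zero_mem' := ⟨0, V.zero_mem, hasBoundaryFunction_zero.congr (Lp.coeFn_zero ℂ 2 volume).symm⟩
  add_mem' := by
    rintro f g ⟨F, hF, hFf⟩ ⟨G, hG, hGg⟩
    exact ⟨F + G, V.add_mem hF hG, (hFf.add hGg).congr (Lp.coeFn_add f g).symm⟩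
  smul_mem' := by
    rintro c f ⟨F, hF, hFf⟩
    exact ⟨c • F, V.smul_mem c hF, (hFf.smul c).congr (Lp.coeFn_smul c f).symm⟩

/-! ### Hardy spaces, inner and outer functions, the Smirnov class -/

/-- Restriction of `F` to the horizontal line at height `y`. -/
def slice (F : ℍ → ℂ) (y : ℝ) (hy : 0 < y) : ℝ → ℂ := fun x => F ⟨⟨x, y⟩, hy⟩

theorem continuous_slice {F : ℍ → ℂ} (hF : Continuous F) (y : ℝ) (hy : 0 < y) :
    Continuous (slice F y hy) := by
  refine hF.comp (UpperHalfPlane.isEmbedding_coe.continuous_iff.2 ?_)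
  have : ((fun z : ℍ => (z : ℂ)) ∘ fun x : ℝ => (⟨⟨x, y⟩, hy⟩ : ℍ))
      = fun x : ℝ => (x : ℂ) + y * Complex.I := by
    funext x
    exact Complex.mk_eq_add_mul_I x y
  rw [this]
  fun_prop

/-- The Hardy space `H²` of the upper half-plane: holomorphic functions whose `L²` norms on
horizontal lines are uniformly bounded. -/
def hardyTwo : Submodule ℂ (ℍ → ℂ) where
  carrier := {F | MDifferentiable 𝓘(ℂ) 𝓘(ℂ) F ∧
    ∃ C : ℝ≥0, ∀ (y : ℝ) (hy : 0 < y), eLpNorm (slice F y hy) 2 volume ≤ C}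
  zero_mem' := by
    refine ⟨mdifferentiable_const, 0, fun y hy => ?_⟩
    have : slice 0 y hy = 0 := rfl
    simp [this]
  add_mem' := by
    rintro F G ⟨hF, C, hC⟩ ⟨hG, D, hD⟩
    refine ⟨hF.add hG, C + D, fun y hy => ?_⟩
    have : slice (F + G) y hy = slice F y hy + slice G y hy := rfl
    rw [this, ENNReal.coe_add]
    exact (eLpNorm_add_le (continuous_slice hF.continuous y hy).aestronglyMeasurable
      (continuous_slice hG.continuous y hy).aestronglyMeasurable (by norm_num)).trans
      (add_le_add (hC y hy) (hD y hy))
  smul_mem' := by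
    rintro c F ⟨hF, C, hC⟩
    refine ⟨hF.const_smul c, ‖c‖₊ * C, fun y hy => ?_⟩
    have : slice (c • F) y hy = c • slice F y hy := rfl
    rw [this, eLpNorm_const_smul, ENNReal.coe_mul, enorm_eq_nnnorm]
    exact mul_le_mul_right (hC y hy) _

/-- Membership in `H^∞` of the upper half-plane: bounded holomorphic functions. -/
def IsHardyInfty (F : ℍ → ℂ) : Prop :=
  MDifferentiable 𝓘(ℂ) 𝓘(ℂ) F ∧ ∃ C : ℝ, ∀ z, ‖F z‖ ≤ C

/-- Inner functions: members of `H^∞` whose boundary values are unimodular almost everywhere. -/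
def IsInner (q : ℍ → ℂ) : Prop :=
  IsHardyInfty q ∧ ∃ f : ℝ → ℂ, HasBoundaryFunction q f ∧ ∀ᵐ x : ℝ, ‖f x‖ = 1

/-- Outer functions on the upper half-plane. Here `k` is the logarithm of the modulus of the
boundary function, with `k ∈ L¹(dt / (1 + t²))`, and `c` is a unimodular constant; the kernel
`(1 + t z) / (t - z) / (1 + t²)` equals `1 / (t - z) - t / (1 + t²)`. -/
def IsOuter (F : ℍ → ℂ) : Prop :=
  ∃ (c : ℂ) (k : ℝ → ℝ), ‖c‖ = 1 ∧ Integrable (fun t : ℝ => k t / (1 + t ^ 2)) ∧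
    ∀ z : ℍ, F z = c * Complex.exp ((1 / (Real.pi * Complex.I)) *
      ∫ t : ℝ, (1 + t * (z : ℂ)) / (t - (z : ℂ)) * ((k t / (1 + t ^ 2) : ℝ) : ℂ))

/-- A function on `ℝ` is in the Smirnov class `N⁺` if it is the boundary function of a quotient
`G / F` with `G, F ∈ H^∞` and `F` outer. -/
def IsSmirnov (f : ℝ → ℂ) : Prop :=
  ∃ G F : ℍ → ℂ, IsHardyInfty G ∧ IsHardyInfty F ∧ IsOuter F ∧
    HasBoundaryFunction (fun z => G z / F z) f

/-- A function on `ℝ` is in the conjugate Smirnov class if its complex conjugate is in `N⁺`. -/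
def IsConjSmirnov (f : ℝ → ℂ) : Prop := IsSmirnov fun x => conj (f x)

/-- The Blaschke factor vanishing at `i`, as a function on `ℝ`. -/
def blaschkeI (x : ℝ) : ℂ := ((x : ℂ) - Complex.I) / ((x : ℂ) + Complex.I)

/-! ### Subspaces of `L²(ℝ)` and generalized Toeplitz operators -/

/-- `H²` as a subspace of `L²(ℝ)`, through boundary functions. -/
def hardyL2 : Submodule ℂ L2 := boundarySpace hardyTwo

/-- `q H²` as a subspace of `L²(ℝ)`, through boundary functions. -/
def mulHardyL2 (q : ℍ → ℂ) : Submodule ℂ L2 :=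
  boundarySpace (hardyTwo.map (LinearMap.mulLeft ℂ q))

/-- Multiplication by `φ ∈ L^∞(ℝ)` on `L²(ℝ)`. -/
def mulOp (φ : ℝ → ℂ) (hφ : MemLp φ ∞ volume) : L2 →L[ℂ] L2 :=
  (ContinuousLinearMap.mul ℂ ℂ).holderL volume ∞ 2 2 (hφ.toLp φ)

/-- The generalized Toeplitz operator: the compression `P_{E₂} M_φ` restricted to `E₁`. In general
`E₂` is replaced by its closure, which makes the orthogonal projection available; for a closed
`E₂`, such as `q H²` with `q` inner, the closure changes nothing. -/
def genToeplitz (E₁ E₂ : Submodule ℂ L2) (φ : ℝ → ℂ) (hφ : MemLp φ ∞ volume) :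
    E₁ →L[ℂ] E₂.topologicalClosure :=
  E₂.topologicalClosure.orthogonalProjectionOnto ∘L mulOp φ hφ ∘L E₁.subtypeL

/-- The kernel of the generalized Toeplitz operator, as a subspace of `L²(ℝ)`. -/
def toeplitzKernel (E₁ E₂ : Submodule ℂ L2) (φ : ℝ → ℂ) (hφ : MemLp φ ∞ volume) :
    Submodule ℂ L2 :=
  (LinearMap.ker (genToeplitz E₁ E₂ φ hφ).toLinearMap).map E₁.subtype

theorem memLp_div {g h : ℝ → ℂ} (hh : MemLp h ∞ volume)
    (hg : MemLp (fun x => (g x)⁻¹) ∞ volume) : MemLp (fun x => h x / g x) ∞ volume := by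
  simpa only [div_eq_mul_inv] using! hg.mul (r := ∞) hh

theorem norm_blaschkeI (x : ℝ) : ‖blaschkeI x‖ = 1 := by
  have h : ((x : ℂ) + Complex.I) ≠ 0 := fun h => by simpa using congrArg Complex.im h
  have h2 : ((x : ℂ) - Complex.I) = conj ((x : ℂ) + Complex.I) := by simp [sub_eq_add_neg]
  rw [blaschkeI, norm_div, h2, RCLike.norm_conj, div_self (norm_ne_zero_iff.2 h)]

theorem memLp_mul_conj_blaschkeI {φ : ℝ → ℂ} (hφ : MemLp φ ∞ volume) :
    MemLp (fun x => φ x * conj (blaschkeI x)) ∞ volume := by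
  have hm : Measurable blaschkeI := by unfold blaschkeI; fun_prop
  have hb : MemLp (fun x => conj (blaschkeI x)) ∞ (volume : Measure ℝ) :=
    memLp_top_of_bound (Complex.continuous_conj.measurable.comp hm).aestronglyMeasurable 1
      (Eventually.of_forall fun x => by rw [RCLike.norm_conj, norm_blaschkeI])
  exact hb.mul (r := ∞) hφ

/-! ### Multipliers -/

/-- For a subspace `X` of `H² ⊆ L²(ℝ)`, the same space regarded as a space of holomorphic functions
on the upper half-plane. -/
def analyticSpace (X : Submodule ℂ L2) : Submodule ℂ (ℍ → ℂ) where
  carrier := {F | F ∈ hardyTwo ∧ ∃ f ∈ X, HasBoundaryFunction F f}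
  zero_mem' := ⟨hardyTwo.zero_mem, 0, X.zero_mem,
    hasBoundaryFunction_zero.congr (Lp.coeFn_zero ℂ 2 volume).symm⟩
  add_mem' := by
    rintro F G ⟨hF, f, hf, hFf⟩ ⟨hG, g, hg, hGg⟩
    exact ⟨hardyTwo.add_mem hF hG, f + g, X.add_mem hf hg,
      (hFf.add hGg).congr (Lp.coeFn_add f g).symm⟩
  smul_mem' := by
    rintro c F ⟨hF, f, hf, hFf⟩
    exact ⟨hardyTwo.smul_mem c hF, c • f, X.smul_mem c hf,
      (hFf.smul c).congr (Lp.coeFn_smul c f).symm⟩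

/-- The multiplier space `M⁺(X, Y)`: the holomorphic functions `ψ` on the upper half-plane such
that `ψ X ⊆ Y`. -/
def multipliers (X Y : Submodule ℂ L2) : Submodule ℂ (ℍ → ℂ) where
  carrier := {ψ | MDifferentiable 𝓘(ℂ) 𝓘(ℂ) ψ ∧
    ∀ F ∈ analyticSpace X, ψ * F ∈ analyticSpace Y}
  zero_mem' := ⟨mdifferentiable_const, fun F _ => by
    rw [zero_mul]; exact (analyticSpace Y).zero_mem⟩
  add_mem' := by
    rintro φ ψ ⟨hφ, h1⟩ ⟨hψ, h2⟩
    refine ⟨hφ.add hψ, fun F hF => ?_⟩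
    rw [add_mul]
    exact (analyticSpace Y).add_mem (h1 F hF) (h2 F hF)
  smul_mem' := by
    rintro c ψ ⟨hψ, h⟩
    refine ⟨hψ.const_smul c, fun F hF => ?_⟩
    rw [smul_mul_assoc]
    exact (analyticSpace Y).smul_mem c (h F hF)

/-- Functions on the upper half-plane whose boundary function exists and lies in `L²(ℝ)`. -/
def boundaryInL2 : Submodule ℂ (ℍ → ℂ) where
  carrier := {F | ∃ f : L2, HasBoundaryFunction F f}
  zero_mem' := ⟨0, hasBoundaryFunction_zero.congr (Lp.coeFn_zero ℂ 2 volume).symm⟩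
  add_mem' := by
    rintro F G ⟨f, hf⟩ ⟨g, hg⟩
    exact ⟨f + g, (hf.add hg).congr (Lp.coeFn_add f g).symm⟩
  smul_mem' := by
    rintro c F ⟨f, hf⟩
    exact ⟨c • f, (hf.smul c).congr (Lp.coeFn_smul c f).symm⟩

/-- The space `M₂⁺(X, Y) = M⁺(X, Y) ∩ L²(ℝ)`. -/
def multipliersTwo (X Y : Submodule ℂ L2) : Submodule ℂ (ℍ → ℂ) :=
  multipliers X Y ⊓ boundaryInL2

end HalfPlane

end

noncomputable section

namespace HalfPlane

/-! ### Integrals over horizontal lines -/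

/-! Put φ = h/g and ψ(z) = 1/(z + i). On ℝ one has ψ = b·conj ψ with b = `blaschkeI`, so φψ =
(φb)·conj ψ. Since φb is bounded and conjugate Smirnov, it behaves like the conjugate of an H^∞
function. Hence φψ is orthogonal to H², a fortiori to qH², and ψ is a nonzero element of the kernel
of symbol φ: this is (2). In the same way, if u lies in the kernel of symbol g, then hψu = (φb)·conj
ψ·gu. Pairing with e ∈ qH² moves conj(φb) and ψ onto e, which stays in qH², while gu is orthogonal
to qH². So ψ is a multiplier, which is (3). Finally f and bf are independent elements of the kernel
of symbol φ·conj b whenever f ≠ 0 is in the kernel of symbol φ, so (2) gives (1). These are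
`inv_add_I_mem_toeplitzKernel`, `inv_add_I_mem_multipliersTwo` and `two_le_rank_toeplitzKernel`.

The analytic core is `integral_smirnov_mul_eq_zero`, a weak form of N⁺ ∩ L^∞ = H^∞: an L¹ density
that annihilates all translates M(x + iδ) of bounded holomorphic M annihilates every bounded
boundary function N of a quotient G/F with F outer. Multiplying G/F by outer functions V_n with
|V_n| ≤ 1 makes it bounded; V_n(i) → 1 then forces suitable translates of V_n to tend to 1 almost
everywhere along a subsequence. That step is the Poisson formula at i, derived from the
orthogonality of H² to 1/(x - i), itself an application of Cauchy's theorem on horizontal strips.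
Only translates of V_n are used, so no boundary values of V_n are needed. -/

/-- Two horizontal integrals of a holomorphic function agree when it is integrable over the strip
between the two lines. -/
theorem integral_line_eq {H : ℂ → ℂ} (hH : DifferentiableOn ℂ H {z | 0 < z.im}) {a b : ℝ}
    (ha : 0 < a) (hab : a ≤ b)
    (hstrip : Integrable (fun p : ℝ × ℝ => H (p.1 + p.2 * Complex.I))
      ((volume : Measure ℝ).prod (volume.restrict (Set.Ioc a b))))
    (hHa : Integrable fun x : ℝ => H (x + a * Complex.I))
    (hHb : Integrable fun x : ℝ => H (x + b * Complex.I)) :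
    ∫ x : ℝ, H (x + a * Complex.I) = ∫ x : ℝ, H (x + b * Complex.I) := by
  set J : ℝ → ℂ := fun T => ∫ y in a..b, H (T + y * Complex.I) with hJ
  have hJi : Integrable J := by
    have := hstrip.integral_prod_left
    simpa only [hJ, intervalIntegral.integral_of_le hab] using this
  have hrect : ∀ T : ℝ, (∫ x in -T..T, H (x + a * Complex.I)) -
      (∫ x in -T..T, H (x + b * Complex.I)) = Complex.I * J (-T) - Complex.I * J T := by
    intro T
    have := Complex.integral_boundary_rect_eq_zero_of_differentiableOn H (⟨-T, a⟩ : ℂ) ⟨T, b⟩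
      (hH.mono fun z hz => by
        have h2 := hz.2
        simp only [Set.mem_preimage, Set.uIcc_of_le hab] at h2
        exact ha.trans_le h2.1)
    simp only [smul_eq_mul] at this
    rw [hJ]
    push_cast at this ⊢
    linear_combination this
  have hlim : Tendsto (fun T : ℝ => Complex.I * J (-T) - Complex.I * J T) atTop
      (𝓝 ((∫ x : ℝ, H (x + a * Complex.I)) - ∫ x : ℝ, H (x + b * Complex.I))) := by
    simp_rw [← hrect]
    exact (intervalIntegral_tendsto_integral hHa tendsto_neg_atTop_atBot tendsto_id).sub
      (intervalIntegral_tendsto_integral hHb tendsto_neg_atTop_atBot tendsto_id)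
  -- No decay of the vertical sides is assumed: they are integrable in T by Fubini on the strip, and
  -- an integrable function that has a limit at infinity has limit 0.
  have hint : Integrable (fun T : ℝ => Complex.I * J (-T) - Complex.I * J T) :=
    (hJi.comp_neg.const_mul _).sub (hJi.const_mul _)
  refine sub_eq_zero.1 (IntegrableAtFilter.eq_zero_of_tendsto (μ := volume)
    (hint.integrableAtFilter atTop) ?_ hlim)
  intro s hs
  obtain ⟨t, ht⟩ := mem_atTop_sets.1 hs
  exact measure_mono_top (fun x hx => ht x hx) (Real.volume_Ici (a := t))

/-- Bounded sequences in `L²` that converge almost everywhere converge weakly. -/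
theorem tendsto_integral_mul_of_eLpNorm_le {f : ℕ → ℝ → ℂ} {e w : ℝ → ℂ} {C : ℝ≥0}
    (hf : ∀ n, AEStronglyMeasurable (f n)) (hC : ∀ n, eLpNorm (f n) 2 volume ≤ C)
    (he : MemLp e 2) (hw : MemLp w 2)
    (hlim : ∀ᵐ x, Tendsto (fun n => f n x) atTop (𝓝 (e x))) :
    Tendsto (fun n => ∫ x, f n x * w x) atTop (𝓝 (∫ x, e x * w x)) := by
  have hbound : ∀ n (s : Set ℝ), MeasurableSet s →
      eLpNorm (s.indicator fun x => f n x * w x) 1 volume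
        ≤ C * eLpNorm (s.indicator w) 2 volume := by
    intro n s hs
    have h1 : (s.indicator fun x => f n x * w x) = f n • s.indicator w := by
      ext x; by_cases hx : x ∈ s <;> simp [hx]
    rw [h1]
    exact (eLpNorm_smul_le_mul_eLpNorm (hw.1.indicator hs) (hf n)).trans
      (mul_le_mul_left (hC n) _)
  -- Dividing by C + 1 instead of C covers C = 0.
  have hmul : ∀ ε : ℝ≥0∞, (C : ℝ≥0∞) * (ε / (C + 1)) ≤ ε := by
    intro ε
    calc (C : ℝ≥0∞) * (ε / (C + 1)) ≤ (C + 1) * (ε / (C + 1)) := by gcongr; exact le_self_add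
      _ ≤ ε := ENNReal.mul_div_le
  have hC1 : (C : ℝ≥0∞) + 1 ≠ ∞ := by finiteness
  have hL1 : Tendsto (fun n => eLpNorm ((fun x => f n x * w x) - fun x => e x * w x) 1 volume)
      atTop (𝓝 0) := by
    -- Vitali's theorem: by Hölder, the products inherit uniform integrability and tightness from
    -- the fixed function w.
    refine tendsto_Lp_of_tendsto_ae le_rfl ENNReal.one_ne_top (fun n => (hf n).mul hw.1)
      (hw.mul' he) ?_ ?_ ?_
    · intro ε hε
      have hε' : 0 < ε / (C + 1) := by positivity
      obtain ⟨δ, hδ, h⟩ := hw.eLpNorm_indicator_le (by norm_num) (by norm_num) hε'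
      refine ⟨δ, hδ, fun n s hs hμ => (hbound n s hs).trans ((mul_le_mul_right (h s hs hμ) _).trans ?_)⟩
      refine le_trans (le_of_eq ?_) (hmul (ENNReal.ofReal ε))
      rw [ENNReal.ofReal_div_of_pos (by positivity), ENNReal.ofReal_add (by positivity) (by positivity)]
      simp
    · intro ε hε
      obtain ⟨s, hs, hμ, h⟩ := hw.exists_eLpNorm_indicator_compl_lt (by norm_num)
        (ε := (ε : ℝ≥0∞) / (C + 1)) (ENNReal.div_pos (by exact_mod_cast hε.ne') hC1).ne'
      exact ⟨s, hμ.ne, fun n => (hbound n _ hs.compl).trans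
        ((mul_le_mul_right h.le _).trans (hmul ε))⟩
    · filter_upwards [hlim] with x hx using hx.mul_const _
  have hfL : ∀ n, MemLp (f n) 2 := fun n => ⟨hf n, (hC n).trans_lt ENNReal.coe_lt_top⟩
  exact tendsto_integral_of_L1' _ (hw.mul' (r := 1) he).1
    (Eventually.of_forall fun n => memLp_one_iff_integrable.1 (hw.mul' (hfL n))) hL1

theorem add_mul_I_ne_zero (x : ℝ) {s : ℝ} (hs : 0 < s) : (x : ℂ) + s * Complex.I ≠ 0 :=
  fun h => hs.ne' (by simpa using congrArg Complex.im h)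

/-- The squared modulus is π/s times a Cauchy density, whose mass is 1. The decay in s is what makes
horizontal integrals vanish at great height. -/
theorem eLpNorm_inv_add_mul_I {s : ℝ} (hs : 0 < s) :
    eLpNorm (fun x : ℝ => ((x : ℂ) + s * Complex.I)⁻¹) 2 volume
      = ENNReal.ofReal (√(Real.pi / s)) := by
  have hn : ∀ x : ℝ, ‖((x : ℂ) + s * Complex.I)⁻¹‖ ^ 2
      = Real.pi / s * ProbabilityTheory.cauchyPDFReal 0 s.toNNReal x := by
    intro x
    rw [norm_inv, inv_pow, ← Complex.normSq_eq_norm_sq, Complex.normSq_add_mul_I,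
      ProbabilityTheory.cauchyPDFReal_def, sub_zero]
    have : (0 : ℝ) < x ^ 2 + s ^ 2 := by positivity
    rw [Real.coe_toNNReal _ hs.le]
    field_simp
  rw [eLpNorm_eq_lintegral_rpow_enorm_toReal (by norm_num) (by norm_num)]
  have h1 : ∀ x : ℝ, ‖((x : ℂ) + s * Complex.I)⁻¹‖ₑ ^ (2 : ℝ)
      = ENNReal.ofReal (Real.pi / s * ProbabilityTheory.cauchyPDFReal 0 s.toNNReal x) := by
    intro x
    rw [← hn, ← ofReal_norm, ENNReal.ofReal_rpow_of_nonneg (norm_nonneg _) (by norm_num)]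
    norm_num
  have hs' : s.toNNReal ≠ 0 := (Real.toNNReal_pos.2 hs).ne'
  simp only [ENNReal.toReal_ofNat, h1]
  rw [← ofReal_integral_eq_lintegral_ofReal
    ((ProbabilityTheory.integrable_cauchyPDFReal 0).const_mul _)
    (Eventually.of_forall fun x => (sq_nonneg _).trans_eq (hn x)), integral_const_mul,
    ProbabilityTheory.integral_cauchyPDFReal_eq_one 0 hs', mul_one, Real.sqrt_eq_rpow,
    ENNReal.ofReal_rpow_of_nonneg (by positivity) (by norm_num)]

theorem memLp_inv_add_mul_I {s : ℝ} (hs : 0 < s) :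
    MemLp (fun x : ℝ => ((x : ℂ) + s * Complex.I)⁻¹) 2 := by
  refine ⟨Continuous.aestronglyMeasurable ?_, by
    rw [eLpNorm_inv_add_mul_I hs]; exact ENNReal.ofReal_lt_top⟩
  exact Continuous.inv₀ (by fun_prop) fun x => add_mul_I_ne_zero x hs

theorem continuous_line {E : ℂ → ℂ} (hE : ContinuousOn E {z | 0 < z.im}) {y : ℝ} (hy : 0 < y) :
    Continuous fun x : ℝ => E (x + y * Complex.I) :=
  hE.comp_continuous (by fun_prop) fun x => by simpa using hy

/-- For `E ∈ H²`, the horizontal integrals of `E(z) / (z + i)` vanish. -/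
theorem integral_line_div_eq_zero {E : ℂ → ℂ} (hE : DifferentiableOn ℂ E {z | 0 < z.im}) {C : ℝ≥0}
    (hC : ∀ y : ℝ, 0 < y → eLpNorm (fun x : ℝ => E (x + y * Complex.I)) 2 volume ≤ C)
    {y : ℝ} (hy : 0 < y) :
    ∫ x : ℝ, E (x + y * Complex.I) * (x + (y + 1 : ℝ) * Complex.I)⁻¹ = 0 := by
  set H : ℂ → ℂ := fun z => E z * (z + Complex.I)⁻¹ with hH
  have hHd : DifferentiableOn ℂ H {z | 0 < z.im} := by
    refine hE.mul (DifferentiableOn.inv (by fun_prop) fun z hz h => ?_)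
    have := congrArg Complex.im h
    simp only [Complex.add_im, Complex.I_im, Complex.zero_im] at this
    simp only [Set.mem_ofPred_eq] at hz
    linarith
  have hHl : ∀ x y : ℝ, H (x + y * Complex.I)
      = E (x + y * Complex.I) * (x + (y + 1 : ℝ) * Complex.I)⁻¹ := by
    intro x y
    simp only [hH]
    congr 2
    push_cast
    ring
  have hcont : ∀ y : ℝ, 0 < y → Continuous fun x : ℝ => H (x + y * Complex.I) :=
    fun y hy => continuous_line hHd.continuousOn hy
  have hnorm : ∀ y : ℝ, 0 < y → eLpNorm (fun x : ℝ => H (x + y * Complex.I)) 1 volume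
      ≤ C * ENNReal.ofReal (√(Real.pi / (y + 1))) := by
    intro y hy
    have h1 : (fun x : ℝ => H (x + y * Complex.I)) = (fun x : ℝ => E (x + y * Complex.I)) •
        fun x : ℝ => ((x : ℂ) + (y + 1 : ℝ) * Complex.I)⁻¹ := by
      ext x; rw [hHl]; rfl
    rw [h1]
    refine (eLpNorm_smul_le_mul_eLpNorm (p := 2) (q := 2) (memLp_inv_add_mul_I (by positivity)).1
      (continuous_line hE.continuousOn hy).aestronglyMeasurable).trans ?_
    rw [eLpNorm_inv_add_mul_I (by positivity)]
    exact mul_le_mul_left (hC y hy) _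
  have hint : ∀ y : ℝ, 0 < y → Integrable fun x : ℝ => H (x + y * Complex.I) := by
    intro y hy
    refine memLp_one_iff_integrable.1 ⟨(hcont y hy).aestronglyMeasurable, ?_⟩
    exact (hnorm y hy).trans_lt (by finiteness)
  have hnormR : ∀ y : ℝ, 0 < y → ∫ x : ℝ, ‖H (x + y * Complex.I)‖
      ≤ C * √(Real.pi / (y + 1)) := by
    intro y hy
    rw [integral_norm_eq_lintegral_enorm (hcont y hy).aestronglyMeasurable,
      ← eLpNorm_one_eq_lintegral_enorm]
    refine ENNReal.toReal_le_of_le_ofReal (by positivity) ((hnorm y hy).trans (le_of_eq ?_))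
    rw [ENNReal.ofReal_mul (by positivity), ENNReal.ofReal_coe_nnreal]
  have heq : ∀ b : ℝ, y ≤ b →
      ∫ x : ℝ, H (x + y * Complex.I) = ∫ x : ℝ, H (x + b * Complex.I) := by
    intro b hb
    refine integral_line_eq hHd hy hb ?_ (hint y hy) (hint b (hy.trans_le hb))
    have hmeas : AEStronglyMeasurable (fun p : ℝ × ℝ => H (p.1 + p.2 * Complex.I))
        ((volume : Measure ℝ).prod (volume.restrict (Set.Ioc y b))) := by
      rw [← Measure.restrict_univ (μ := (volume : Measure ℝ)), Measure.restrict_restrict (by simp),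
        Set.inter_univ, Measure.prod_restrict]
      refine ContinuousOn.aestronglyMeasurable ?_ (by measurability)
      refine hHd.continuousOn.comp (by fun_prop) fun p hp => ?_
      have := hp.2.1
      simpa using hy.trans this
    rw [integrable_prod_iff' hmeas]
    refine ⟨?_, ?_⟩
    · filter_upwards [ae_restrict_mem measurableSet_Ioc] with t ht using hint t (hy.trans ht.1)
    · refine Integrable.of_bound (C := C * √Real.pi) hmeas.norm.prod_swap.integral_prod_right' ?_
      filter_upwards [ae_restrict_mem measurableSet_Ioc] with t ht
      have ht0 : 0 < t := hy.trans ht.1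
      rw [Real.norm_of_nonneg (integral_nonneg fun _ => norm_nonneg _)]
      refine (hnormR t ht0).trans ?_
      gcongr
      exact div_le_self Real.pi_pos.le (by linarith)
  have hzero : Tendsto (fun b : ℝ => (C : ℝ) * √(Real.pi / (b + 1))) atTop (𝓝 0) := by
    have : Tendsto (fun b : ℝ => Real.pi / (b + 1)) atTop (𝓝 0) :=
      tendsto_const_nhds.div_atTop (tendsto_atTop_add_const_right _ _ tendsto_id)
    simpa using (this.sqrt).const_mul (C : ℝ)
  simp_rw [← hHl]
  -- The integral does not depend on the height, and its bound tends to 0 as the height grows.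
  refine norm_le_zero_iff.1 (ge_of_tendsto hzero ?_)
  filter_upwards [eventually_ge_atTop y] with b hb
  rw [heq b hb]
  exact (norm_integral_le_integral_norm _).trans (hnormR b (hy.trans_le hb))

/-- If `e` is the boundary function of `E ∈ H²`, then `e` is orthogonal to `1 / (x - i)`. -/
theorem integral_boundary_div_eq_zero {E : ℂ → ℂ} (hE : DifferentiableOn ℂ E {z | 0 < z.im})
    {C : ℝ≥0} (hC : ∀ y : ℝ, 0 < y → eLpNorm (fun x : ℝ => E (x + y * Complex.I)) 2 volume ≤ C)
    {e : ℝ → ℂ} (he : MemLp e 2)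
    (hlim : ∀ᵐ x : ℝ, Tendsto (fun y : ℝ => E (x + y * Complex.I)) (𝓝[>] 0) (𝓝 (e x))) :
    ∫ x : ℝ, e x * ((x : ℂ) + Complex.I)⁻¹ = 0 := by
  obtain ⟨y, -, hy0, hylim⟩ := exists_seq_strictAnti_tendsto (0 : ℝ)
  have hyw : Tendsto y atTop (𝓝[>] 0) := tendsto_nhdsWithin_iff.2
    ⟨hylim, Eventually.of_forall hy0⟩
  -- The ratio of the weight on the line at height y n to the limiting weight 1/(x + i). Absorbing
  -- it into the sequence leaves a fixed weight, and |r| ≤ 1 preserves the L² bound.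
  set r : ℕ → ℝ → ℂ := fun n x => (x + Complex.I) * (x + (y n + 1 : ℝ) * Complex.I)⁻¹ with hr
  have hrc : ∀ n, Continuous (r n) := fun n => Continuous.mul (by fun_prop)
    (Continuous.inv₀ (by fun_prop) fun x => add_mul_I_ne_zero x (by have := hy0 n; positivity))
  have hr1 : ∀ n x, ‖r n x‖ ≤ 1 := by
    intro n x
    have h0 := hy0 n
    have h1 : ‖(x : ℂ) + Complex.I‖ ≤ ‖(x : ℂ) + (y n + 1 : ℝ) * Complex.I‖ := by
      have := Complex.norm_add_mul_I x 1
      rw [Complex.ofReal_one, one_mul] at this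
      rw [this, Complex.norm_add_mul_I]
      gcongr
      linarith
    rw [hr]
    simp only [norm_mul, norm_inv]
    exact mul_inv_le_one_of_le₀ h1 (norm_nonneg _)
  have hrl : ∀ x, Tendsto (fun n => r n x) atTop (𝓝 1) := by
    intro x
    have hx : (x : ℂ) + Complex.I ≠ 0 := by simpa using add_mul_I_ne_zero x one_pos
    have h1 : Tendsto (fun n => (x : ℂ) + (y n + 1 : ℝ) * Complex.I) atTop
        (𝓝 (x + Complex.I)) := by
      have : Continuous fun t : ℝ => (x : ℂ) + (t + 1 : ℝ) * Complex.I := by fun_prop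
      simpa [Function.comp_def] using! (this.tendsto 0).comp hylim
    simpa [hr, mul_inv_cancel₀ hx] using (h1.inv₀ hx).const_mul ((x : ℂ) + Complex.I)
  have key := tendsto_integral_mul_of_eLpNorm_le
    (f := fun n x => E (x + y n * Complex.I) * r n x) (C := C)
    (fun n => ((continuous_line hE.continuousOn (hy0 n)).mul (hrc n)).aestronglyMeasurable)
    (fun n => (eLpNorm_mono fun x => by
      rw [norm_mul]; exact mul_le_of_le_one_right (norm_nonneg _) (hr1 n x)).trans (hC _ (hy0 n)))
    he (by simpa using memLp_inv_add_mul_I one_pos) (w := fun x => ((x : ℂ) + Complex.I)⁻¹)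
    (by
      filter_upwards [hlim] with x hx
      simpa using (hx.comp hyw).mul (hrl x))
  have hzero : ∀ n, ∫ x : ℝ, E (x + y n * Complex.I) * r n x * ((x : ℂ) + Complex.I)⁻¹ = 0 := by
    intro n
    rw [← integral_line_div_eq_zero hE hC (hy0 n)]
    congr 1 with x
    have hx : (x : ℂ) + Complex.I ≠ 0 := by simpa using add_mul_I_ne_zero x one_pos
    simp only [hr]
    field_simp
  simp only [hzero] at key
  exact tendsto_nhds_unique key tendsto_const_nhds

/-! ### The Poisson formula for bounded functions -/

theorem add_I_ne_zero {z : ℂ} (hz : 0 ≤ z.im) : z + Complex.I ≠ 0 := fun h => by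
  have := congrArg Complex.im h
  simp only [Complex.add_im, Complex.I_im, Complex.zero_im] at this
  linarith

/-- A function dominated by `1 / |z + i|` has bounded `L²` norms on horizontal lines. -/
theorem eLpNorm_line_le_of_norm_le {Q : ℂ → ℂ} {K : ℝ} (hK : 0 ≤ K)
    (hQ : ∀ z : ℂ, 0 ≤ z.im → ‖Q z‖ ≤ K * ‖(z + Complex.I)⁻¹‖) {y : ℝ} (hy : 0 ≤ y) :
    eLpNorm (fun x : ℝ => Q (x + y * Complex.I)) 2 volume
      ≤ (K * √Real.pi).toNNReal := by
  have h1 : ∀ x : ℝ, ‖Q (x + y * Complex.I)‖ ≤ K * ‖((x : ℂ) + (y + 1 : ℝ) * Complex.I)⁻¹‖ := by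
    intro x
    refine (hQ _ (by simpa using hy)).trans (le_of_eq ?_)
    congr 3
    push_cast
    ring
  refine (eLpNorm_le_mul_eLpNorm_of_ae_le_mul (Eventually.of_forall h1) 2).trans ?_
  rw [eLpNorm_inv_add_mul_I (by positivity), ← ENNReal.ofReal_mul hK]
  refine ENNReal.ofReal_le_ofReal ?_
  gcongr
  exact div_le_self Real.pi_pos.le (by linarith)

theorem integrable_inv_one_add_sq_complex :
    Integrable fun x : ℝ => (((1 + x ^ 2)⁻¹ : ℝ) : ℂ) :=
  integrable_inv_one_add_sq.ofReal

/-- The Poisson formula at `i` for a bounded holomorphic function on a slightly larger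
half-plane. -/
theorem integral_line_mul_inv_one_add_sq {W : ℂ → ℂ} {δ B : ℝ} (hδ : 0 < δ)
    (hW : DifferentiableOn ℂ W {z | -δ < z.im}) (hB : ∀ z : ℂ, -δ < z.im → ‖W z‖ ≤ B) :
    ∫ x : ℝ, W x * (((1 + x ^ 2)⁻¹ : ℝ) : ℂ) = Real.pi * W Complex.I := by
  have hopen : IsOpen {z : ℂ | -δ < z.im} := isOpen_lt continuous_const Complex.continuous_im
  have hI : -δ < Complex.I.im := by rw [Complex.I_im]; linarith
  have hB0 : 0 ≤ B := (norm_nonneg _).trans (hB _ hI)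
  -- On ℝ, Q(x)/(x + i) = (W(x) - W(i))/(1 + x²), so the orthogonality relation for Q is the Poisson
  -- formula for W.
  set Q : ℂ → ℂ := dslope W Complex.I with hQ
  have hQd : DifferentiableOn ℂ Q {z | -δ < z.im} :=
    (Complex.differentiableOn_dslope (hopen.mem_nhds hI)).2 hW
  have hQne : ∀ z, z ≠ Complex.I → Q z = (W z - W Complex.I) / (z - Complex.I) := by
    intro z hz
    rw [hQ, dslope_of_ne _ hz, slope_def_field]
  obtain ⟨B₁, hB₁⟩ := (isCompact_closedBall Complex.I (1 / 2)).exists_bound_of_continuousOn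
    (hQd.continuousOn.mono fun z hz => by
      have h1 := (Complex.abs_im_le_norm (z - Complex.I)).trans (mem_closedBall_iff_norm.1 hz)
      have h2 := (abs_le.1 h1).1
      simp only [Complex.sub_im, Complex.I_im] at h2
      simp only [Set.mem_ofPred_eq]
      linarith)
  have hB₁0 : 0 ≤ B₁ := (norm_nonneg _).trans (hB₁ Complex.I (by simp))
  -- Within 1/2 of i, |Q| ≤ B₁ and |z + i| ≤ 5/2. Farther away the numerator is at most 2B and |z +
  -- i| ≤ 5|z - i|.
  have hQb : ∀ z : ℂ, 0 ≤ z.im → ‖Q z‖ ≤ (10 * B + 5 / 2 * B₁) * ‖(z + Complex.I)⁻¹‖ := by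
    intro z hz
    have hpos : 0 < ‖z + Complex.I‖ := norm_pos_iff.2 (add_I_ne_zero hz)
    rw [norm_inv, ← div_eq_mul_inv, le_div_iff₀ hpos]
    have htri : ‖z + Complex.I‖ ≤ ‖z - Complex.I‖ + 2 := by
      have : z + Complex.I = (z - Complex.I) + 2 * Complex.I := by ring
      rw [this]
      refine (norm_add_le _ _).trans ?_
      simp
    rcases le_or_gt ‖z - Complex.I‖ (1 / 2) with h | h
    · have h1 := hB₁ z (mem_closedBall_iff_norm.2 h)
      have := mul_le_mul h1 (by linarith : ‖z + Complex.I‖ ≤ 5 / 2) hpos.le hB₁0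
      linarith
    · have hne : z ≠ Complex.I := by
        rintro rfl
        norm_num at h
      have h0 : 0 < ‖z - Complex.I‖ := by linarith
      have h1 : ‖W z - W Complex.I‖ ≤ 2 * B :=
        (norm_sub_le _ _).trans (by linarith [hB z (by linarith), hB _ hI])
      rw [hQne z hne, norm_div, div_mul_eq_mul_div, div_le_iff₀ h0]
      have h2 : ‖z + Complex.I‖ ≤ 5 * ‖z - Complex.I‖ := by linarith
      have := mul_le_mul h1 h2 hpos.le (by linarith)
      nlinarith [mul_nonneg hB₁0 h0.le]
  have hQc : ∀ x : ℝ, ContinuousAt Q x := fun x =>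
    (hQd.differentiableAt (hopen.mem_nhds (by simpa using hδ))).continuousAt
  have hWc : ∀ x : ℝ, ContinuousAt W x := fun x =>
    (hW.differentiableAt (hopen.mem_nhds (by simpa using hδ))).continuousAt
  have hcont : Continuous fun x : ℝ => Q x := continuous_iff_continuousAt.2 fun x =>
    (hQc x).comp (f := fun x : ℝ => (x : ℂ)) Complex.continuous_ofReal.continuousAt
  have hWcont : Continuous fun x : ℝ => W x := continuous_iff_continuousAt.2 fun x =>
    (hWc x).comp (f := fun x : ℝ => (x : ℂ)) Complex.continuous_ofReal.continuousAt
  have hK : 0 ≤ 10 * B + 5 / 2 * B₁ := by positivity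
  have key := integral_boundary_div_eq_zero
    (hQd.mono fun z (hz : 0 < z.im) => (by linarith : -δ < 0).trans hz)
    (fun y hy => eLpNorm_line_le_of_norm_le hK hQb hy.le) (e := fun x : ℝ => Q x)
    ⟨hcont.aestronglyMeasurable, by
      simpa using (eLpNorm_line_le_of_norm_le hK hQb le_rfl).trans_lt ENNReal.coe_lt_top⟩
    (Eventually.of_forall fun x => by
      have h1 : Continuous fun y : ℝ => (x : ℂ) + y * Complex.I := by fun_prop
      have h2 : Tendsto (fun y : ℝ => (x : ℂ) + y * Complex.I) (𝓝[>] 0) (𝓝 (x : ℂ)) := by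
        simpa using (h1.tendsto 0).mono_left nhdsWithin_le_nhds
      exact (hQc x).tendsto.comp h2)
  have hterm : ∀ x : ℝ, Q x * ((x : ℂ) + Complex.I)⁻¹
      = W x * (((1 + x ^ 2)⁻¹ : ℝ) : ℂ) - W Complex.I * (((1 + x ^ 2)⁻¹ : ℝ) : ℂ) := by
    intro x
    have hx : (x : ℂ) + Complex.I ≠ 0 := add_I_ne_zero (by simp)
    have hx' : (x : ℂ) - Complex.I ≠ 0 := fun h => by simpa using congrArg Complex.im h
    have hp : (1 + (x : ℂ) ^ 2) = (x - Complex.I) * (x + Complex.I) := by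
      ring_nf
      rw [Complex.I_sq]
      ring
    rw [hQne x (sub_ne_zero.1 hx')]
    push_cast
    rw [hp]
    field_simp
  have hint : Integrable fun x : ℝ => W x * (((1 + x ^ 2)⁻¹ : ℝ) : ℂ) :=
    integrable_inv_one_add_sq_complex.bdd_mul hWcont.aestronglyMeasurable (c := B)
      (Eventually.of_forall fun x => hB x (by simpa using hδ))
  simp only [hterm] at key
  rw [integral_sub hint (integrable_inv_one_add_sq_complex.const_mul _), integral_const_mul,
    integral_complex_ofReal, integral_univ_inv_one_add_sq] at key
  linear_combination key

/-- A holomorphic function bounded by `1` whose value at `i` is close to `1` is close to `1` on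
average. -/
theorem integral_norm_one_sub_sq_le {W : ℂ → ℂ} {δ : ℝ} (hδ : 0 < δ)
    (hW : DifferentiableOn ℂ W {z | -δ < z.im}) (hB : ∀ z : ℂ, -δ < z.im → ‖W z‖ ≤ 1) :
    Integrable (fun x : ℝ => ‖1 - W x‖ ^ 2 * (1 + x ^ 2)⁻¹) ∧
    ∫ x : ℝ, ‖1 - W x‖ ^ 2 * (1 + x ^ 2)⁻¹ ≤ 2 * Real.pi * ‖1 - W Complex.I‖ := by
  have hWcont : Continuous fun x : ℝ => W x :=
    hW.continuousOn.comp_continuous Complex.continuous_ofReal fun x => by simpa using hδ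
  have hb : ∀ x : ℝ, ‖W x‖ ≤ 1 := fun x => hB x (by simpa using hδ)
  have hint : Integrable (fun x : ℝ => ‖1 - W x‖ ^ 2 * (1 + x ^ 2)⁻¹) := by
    refine integrable_inv_one_add_sq.bdd_mul
      ((continuous_const.sub hWcont).norm.pow 2).aestronglyMeasurable (c := 4)
      (Eventually.of_forall fun x => ?_)
    have h1 : ‖1 - W x‖ ≤ 2 := (norm_sub_le _ _).trans (by rw [norm_one]; linarith [hb x])
    rw [norm_pow, norm_norm]
    nlinarith [norm_nonneg (1 - W x)]
  refine ⟨hint, ?_⟩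
  have hintW : Integrable fun x : ℝ => (1 - W x) * (((1 + x ^ 2)⁻¹ : ℝ) : ℂ) :=
    integrable_inv_one_add_sq_complex.bdd_mul
      (continuous_const.sub hWcont).aestronglyMeasurable (c := 2)
      (Eventually.of_forall fun x => (norm_sub_le _ _).trans (by rw [norm_one]; linarith [hb x]))
  have hformula : ∫ x : ℝ, (1 - W x) * (((1 + x ^ 2)⁻¹ : ℝ) : ℂ)
      = Real.pi * (1 - W Complex.I) := by
    have := integral_line_mul_inv_one_add_sq (W := fun z => 1 - W z) (B := 2) hδ
      (hW.const_sub 1) (fun z hz => (norm_sub_le _ _).trans (by rw [norm_one]; linarith [hB z hz]))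
    exact this
  calc ∫ x : ℝ, ‖1 - W x‖ ^ 2 * (1 + x ^ 2)⁻¹
      ≤ ∫ x : ℝ, 2 * ((1 - W x) * (((1 + x ^ 2)⁻¹ : ℝ) : ℂ)).re := by
        refine integral_mono hint (hintW.re.const_mul 2) fun x => ?_
        -- Expanding the square with |W| ≤ 1 leaves an expression linear in W, whose Poisson average
        -- is its value at i.
        have h1 : ‖1 - W x‖ ^ 2 ≤ 2 * (1 - W x).re := by
          have h2 : ‖W x‖ ^ 2 ≤ 1 := pow_le_one₀ (norm_nonneg _) (hb x)
          rw [← Complex.normSq_eq_norm_sq, Complex.normSq_apply] at h2 ⊢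
          simp only [Complex.sub_re, Complex.one_re, Complex.sub_im, Complex.one_im]
          nlinarith
        have h3 : 0 < (1 + x ^ 2)⁻¹ := by positivity
        simp only [Complex.re_mul_ofReal]
        nlinarith
    _ = 2 * (∫ x : ℝ, (1 - W x) * (((1 + x ^ 2)⁻¹ : ℝ) : ℂ)).re := by
        rw [integral_const_mul]
        congr 1
        exact integral_re hintW
    _ ≤ 2 * Real.pi * ‖1 - W Complex.I‖ := by
        rw [hformula, Complex.re_ofReal_mul, mul_assoc]
        have := Complex.re_le_norm (1 - W Complex.I)
        gcongr

/-! ### Outer functions -/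

/-- The exponent of the outer function with logarithmic modulus `κ(t) (1 + t²)`. -/
def outerExponent (κ : ℝ → ℝ) (z : ℂ) : ℂ :=
  (1 / (Real.pi * Complex.I)) * ∫ t : ℝ, (1 + t * z) / (t - z) * (κ t : ℂ)

theorem im_le_norm_ofReal_sub (z : ℂ) (t : ℝ) : z.im ≤ ‖(t : ℂ) - z‖ := by
  have := Complex.abs_im_le_norm ((t : ℂ) - z)
  simp only [Complex.sub_im, Complex.ofReal_im, zero_sub, abs_neg] at this
  exact (le_abs_self _).trans this

theorem ofReal_sub_ne_zero {z : ℂ} (hz : 0 < z.im) (t : ℝ) : (t : ℂ) - z ≠ 0 :=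
  norm_pos_iff.1 (hz.trans_le (im_le_norm_ofReal_sub z t))

theorem integrable_cauchyKernel {κ : ℝ → ℝ} (hκ : Integrable κ) {z : ℂ} (hz : 0 < z.im) :
    Integrable fun t : ℝ => ((t : ℂ) - z)⁻¹ * (κ t : ℂ) := by
  refine hκ.ofReal.bdd_mul (c := z.im⁻¹) ?_ (Eventually.of_forall fun t => ?_)
  · exact (Continuous.inv₀ (by fun_prop) (ofReal_sub_ne_zero hz)).aestronglyMeasurable
  · rw [norm_inv]
    exact inv_anti₀ hz (im_le_norm_ofReal_sub z t)

/-- Splitting off z reduces integrability and holomorphy to the Cauchy kernel. -/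
theorem outerKernel_mul_eq {z : ℂ} (hz : 0 < z.im) (t : ℝ) (c : ℂ) :
    (1 + t * z) / (t - z) * c = z * c + (1 + z ^ 2) * (((t : ℂ) - z)⁻¹ * c) := by
  have := ofReal_sub_ne_zero hz t
  field_simp
  ring

theorem integrable_outerKernel {κ : ℝ → ℝ} (hκ : Integrable κ) {z : ℂ} (hz : 0 < z.im) :
    Integrable fun t : ℝ => (1 + t * z) / (t - z) * (κ t : ℂ) := by
  simp only [outerKernel_mul_eq hz]
  exact (hκ.ofReal.const_mul z).add ((integrable_cauchyKernel hκ hz).const_mul _)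

theorem outerExponent_sub {κ κ' : ℝ → ℝ} (hκ : Integrable κ) (hκ' : Integrable κ') {z : ℂ}
    (hz : 0 < z.im) : outerExponent (κ - κ') z = outerExponent κ z - outerExponent κ' z := by
  unfold outerExponent
  rw [← mul_sub, ← integral_sub (integrable_outerKernel hκ hz) (integrable_outerKernel hκ' hz)]
  congr 2 with t
  simp only [Pi.sub_apply]
  push_cast
  ring

theorem differentiableOn_outerExponent {κ : ℝ → ℝ} (hκ : Integrable κ) :
    DifferentiableOn ℂ (outerExponent κ) {z | 0 < z.im} := by
  have hcauchy : DifferentiableOn ℂ (fun z => ∫ t : ℝ, ((t : ℂ) - z)⁻¹ * (κ t : ℂ))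
      {z | 0 < z.im} := by
    intro z₀ hz₀
    have hz₀ : 0 < z₀.im := hz₀
    have hball : ∀ z ∈ Metric.ball z₀ (z₀.im / 2), z₀.im / 2 < z.im := by
      intro z hz
      have h1 := (Complex.abs_im_le_norm (z - z₀)).trans_lt (mem_ball_iff_norm.1 hz)
      have h2 := (abs_lt.1 h1).1
      simp only [Complex.sub_im] at h2
      linarith
    -- On the ball of radius Im z₀/2 one has |t - z| ≥ Im z₀/2, which gives the dominating function.
    refine (hasDerivAt_integral_of_dominated_loc_of_deriv_le (μ := volume)
      (F' := fun z t => (((t : ℂ) - z) ^ 2)⁻¹ * (κ t : ℂ))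
      (bound := fun t => ((z₀.im / 2) ^ 2)⁻¹ * ‖κ t‖)
      (Metric.ball_mem_nhds z₀ (half_pos hz₀)) ?_ (integrable_cauchyKernel hκ hz₀) ?_ ?_
      (hκ.norm.const_mul _) ?_).2.differentiableAt.differentiableWithinAt
    · filter_upwards [Metric.ball_mem_nhds z₀ (half_pos hz₀)] with z hz
      exact (integrable_cauchyKernel hκ ((half_pos hz₀).trans (hball z hz))).1
    · refine AEStronglyMeasurable.mul (Continuous.aestronglyMeasurable ?_) hκ.ofReal.1
      exact Continuous.inv₀ (by fun_prop) fun t => pow_ne_zero 2 (ofReal_sub_ne_zero hz₀ t)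
    · refine Eventually.of_forall fun t z hz => ?_
      rw [norm_mul, norm_inv, norm_pow, Complex.norm_real]
      have := (hball z hz).le.trans (im_le_norm_ofReal_sub z t)
      gcongr
    · refine Eventually.of_forall fun t z hz => ?_
      have hne := ofReal_sub_ne_zero ((half_pos hz₀).trans (hball z hz)) t
      have := ((((hasDerivAt_id z).const_sub (t : ℂ)).inv hne)).mul_const (κ t : ℂ)
      simpa [div_eq_mul_inv] using this
  have heq : ∀ z ∈ {z : ℂ | 0 < z.im}, outerExponent κ z = (1 / (Real.pi * Complex.I)) *
      (z * (∫ t : ℝ, (κ t : ℂ)) + (1 + z ^ 2) * ∫ t : ℝ, ((t : ℂ) - z)⁻¹ * (κ t : ℂ)) := by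
    intro z hz
    unfold outerExponent
    simp only [outerKernel_mul_eq hz]
    have h1 : Integrable fun t : ℝ => z * (κ t : ℂ) := hκ.ofReal.const_mul z
    rw [integral_add h1 ((integrable_cauchyKernel hκ hz).const_mul _),
      integral_const_mul, integral_const_mul]
  refine DifferentiableOn.congr ?_ heq
  exact DifferentiableOn.const_mul (DifferentiableOn.add (by fun_prop)
    (DifferentiableOn.mul (by fun_prop) hcauchy)) _

/-- The real part of the exponent is a Poisson integral. -/
theorem re_outerExponent {κ : ℝ → ℝ} (hκ : Integrable κ) {z : ℂ} (hz : 0 < z.im) :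
    (outerExponent κ z).re
      = ∫ t : ℝ, ProbabilityTheory.cauchyPDFReal z.re z.im.toNNReal t * ((1 + t ^ 2) * κ t) := by
  unfold outerExponent
  rw [← integral_const_mul]
  refine (integral_re ((integrable_outerKernel hκ hz).const_mul _)).symm.trans ?_
  congr 1 with t
  have hn : (t - z.re) ^ 2 + z.im ^ 2 ≠ 0 := by positivity
  have h1 : (1 + t * z) / (t - z) = ((1 + t * z) * (t - conj z)) *
      ((((t - z.re) ^ 2 + z.im ^ 2)⁻¹ : ℝ) : ℂ) := by
    have h2 : ((t : ℂ) - z) * (t - conj z) = (((t - z.re) ^ 2 + z.im ^ 2 : ℝ) : ℂ) := by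
      have : (t : ℂ) - conj z = conj ((t : ℂ) - z) := by simp
      rw [this, Complex.mul_conj, Complex.normSq_apply]
      simp only [Complex.sub_re, Complex.sub_im, Complex.ofReal_re, Complex.ofReal_im]
      congr 1
      ring
    rw [Complex.ofReal_inv, ← h2]
    have h3 := ofReal_sub_ne_zero hz t
    have h4 : (t : ℂ) - conj z ≠ 0 := fun h => hn (by rw [h, mul_zero] at h2; exact_mod_cast h2.symm)
    field_simp
  have hpi : (1 / (Real.pi * Complex.I) : ℂ) = ((Real.pi⁻¹ : ℝ) : ℂ) * (-Complex.I) := by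
    rw [one_div, mul_inv, Complex.inv_I]
    push_cast
    rfl
  rw [hpi, h1, ProbabilityTheory.cauchyPDFReal_def, Real.coe_toNNReal _ hz.le]
  have h5 : (((Real.pi⁻¹ : ℝ) : ℂ) * (-Complex.I) * ((1 + t * z) * (t - conj z) *
      ((((t - z.re) ^ 2 + z.im ^ 2)⁻¹ : ℝ) : ℂ) * (κ t : ℂ)))
      = ((Real.pi⁻¹ * ((t - z.re) ^ 2 + z.im ^ 2)⁻¹ * κ t : ℝ) : ℂ) *
        (-Complex.I * ((1 + t * z) * (t - conj z))) := by
    push_cast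
    ring
  rw [h5]
  simp only [RCLike.re_to_complex, Complex.re_ofReal_mul]
  simp only [Complex.mul_re, Complex.mul_im, Complex.neg_re, Complex.neg_im, Complex.I_re,
    Complex.I_im, Complex.add_re, Complex.add_im, Complex.sub_re, Complex.sub_im,
    Complex.one_re, Complex.one_im, Complex.ofReal_re, Complex.ofReal_im, Complex.conj_re,
    Complex.conj_im]
  ring

/-- A Poisson average of values at most n is at most n. The condition 0 ≤ n also disposes of the
case where the integral takes its default value 0. -/
theorem re_outerExponent_le {κ : ℝ → ℝ} (hκ : Integrable κ) {n : ℝ} (hn : 0 ≤ n)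
    (hle : ∀ t, (1 + t ^ 2) * κ t ≤ n) {z : ℂ} (hz : 0 < z.im) :
    (outerExponent κ z).re ≤ n := by
  have hpdf := ProbabilityTheory.integrable_cauchyPDFReal z.re (γ := z.im.toNNReal)
  have hγ : z.im.toNNReal ≠ 0 := (Real.toNNReal_pos.2 hz).ne'
  rw [re_outerExponent hκ hz]
  calc _ ≤ ∫ t, ProbabilityTheory.cauchyPDFReal z.re z.im.toNNReal t * n := by
        by_cases hint : Integrable fun t : ℝ =>
            ProbabilityTheory.cauchyPDFReal z.re z.im.toNNReal t * ((1 + t ^ 2) * κ t)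
        · exact integral_mono hint (hpdf.mul_const n) fun t => mul_le_mul_of_nonneg_left (hle t)
            (ProbabilityTheory.cauchyPDF_pos z.re hγ t).le
        · rw [integral_undef hint]
          exact integral_nonneg fun t =>
            mul_nonneg (ProbabilityTheory.cauchyPDF_pos z.re hγ t).le hn
    _ = n := by rw [integral_mul_const, ProbabilityTheory.integral_cauchyPDFReal_eq_one _ hγ, one_mul]

/-- At z = i the kernel is the constant i; hence values at i only see the total mass of the density.
-/
theorem outerExponent_I (κ : ℝ → ℝ) :
    outerExponent κ Complex.I = ((Real.pi⁻¹ * ∫ t, κ t : ℝ) : ℂ) := by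
  have h : ∀ t : ℝ, (1 + t * Complex.I) / (t - Complex.I) = Complex.I := by
    intro t
    rw [div_eq_iff (ofReal_sub_ne_zero (by simp) t)]
    ring_nf
    rw [Complex.I_sq]
    ring
  unfold outerExponent
  simp only [h]
  rw [integral_const_mul, integral_complex_ofReal]
  push_cast
  field_simp

/-! ### Weak-star density of bounded analytic functions in the bounded Smirnov class -/

open UpperHalfPlane (ofComplex)

theorem isOpen_setOf_im_pos : IsOpen {z : ℂ | 0 < z.im} :=
  isOpen_lt continuous_const Complex.continuous_im

theorem HasNTLimit.tendsto_vertical {F : ℍ → ℂ} {x : ℝ} {c : ℂ} (h : HasNTLimit F x c) :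
    Tendsto (fun y : ℝ => F (ofComplex (x + y * Complex.I))) (𝓝[>] 0) (𝓝 c) := by
  refine (h 1 one_pos).comp (tendsto_comap_iff.2 ?_)
  have hcoe : ∀ᶠ y : ℝ in 𝓝[>] 0,
      (x : ℂ) + y * Complex.I = (ofComplex (x + y * Complex.I) : ℂ) := by
    filter_upwards [self_mem_nhdsWithin] with y hy
    rw [UpperHalfPlane.ofComplex_apply_of_im_pos (by simpa using hy)]
  refine Tendsto.congr' hcoe (tendsto_nhdsWithin_iff.2 ⟨?_, ?_⟩)
  · have h1 : Continuous fun y : ℝ => (x : ℂ) + y * Complex.I := by fun_prop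
    simpa using (h1.tendsto 0).mono_left nhdsWithin_le_nhds
  · filter_upwards [self_mem_nhdsWithin] with y hy
    simpa using hy

/-- The density of the truncation at height `-n` of the logarithmic modulus. -/
def truncatedDensity (κ : ℝ → ℝ) (n : ℕ) : ℝ → ℝ := fun t => min 0 (κ t + n * (1 + t ^ 2)⁻¹)

theorem integrable_truncatedDensity {κ : ℝ → ℝ} (hκ : Integrable κ) (n : ℕ) :
    Integrable (truncatedDensity κ n) :=
  (integrable_zero ℝ ℝ volume).inf (hκ.add (integrable_inv_one_add_sq.const_mul (n : ℝ)))

theorem mul_truncatedDensity_le (κ : ℝ → ℝ) (n : ℕ) (t : ℝ) :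
    (1 + t ^ 2) * truncatedDensity κ n t ≤ 0 :=
  mul_nonpos_of_nonneg_of_nonpos (by positivity) (min_le_left _ _)

/-- With k = (1 + t²)κ this is min(0, k + n) - k ≤ n: dividing the truncated outer function by the
original one costs at most a factor exp n. -/
theorem mul_truncatedDensity_sub_le (κ : ℝ → ℝ) (n : ℕ) (t : ℝ) :
    (1 + t ^ 2) * (truncatedDensity κ n - κ) t ≤ n := by
  have h1 : (truncatedDensity κ n - κ) t ≤ n * (1 + t ^ 2)⁻¹ := by
    have := min_le_right 0 (κ t + n * (1 + t ^ 2)⁻¹)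
    simp only [Pi.sub_apply, truncatedDensity]
    linarith
  have h2 : (0 : ℝ) < 1 + t ^ 2 := by positivity
  calc (1 + t ^ 2) * (truncatedDensity κ n - κ) t
      ≤ (1 + t ^ 2) * ((n : ℝ) * (1 + t ^ 2)⁻¹) := by gcongr
    _ = (n : ℝ) := by field_simp

/-- The truncation is dominated by |κ| and vanishes at t once n ≥ |κ(t)|(1 + t²). -/
theorem tendsto_integral_truncatedDensity {κ : ℝ → ℝ} (hκ : Integrable κ) :
    Tendsto (fun n => ∫ t, truncatedDensity κ n t) atTop (𝓝 0) := by
  rw [← integral_zero ℝ ℝ (μ := volume)]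
  refine tendsto_integral_of_dominated_convergence (fun t => ‖κ t‖)
    (fun n => (integrable_truncatedDensity hκ n).1) hκ.norm (fun n => Eventually.of_forall fun t => ?_)
    (Eventually.of_forall fun t => ?_)
  · have h1 : (0 : ℝ) ≤ n * (1 + t ^ 2)⁻¹ := by positivity
    rw [Real.norm_eq_abs, Real.norm_eq_abs, truncatedDensity, abs_of_nonpos (min_le_left _ _),
      neg_le]
    exact le_min (by simp) (by linarith [neg_abs_le (κ t)])
  · refine tendsto_const_nhds.congr' ?_
    filter_upwards [tendsto_natCast_atTop_atTop.eventually_ge_atTop (|κ t| * (1 + t ^ 2))] with n hn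
    have h2 : (0 : ℝ) < 1 + t ^ 2 := by positivity
    have h3 : |κ t| ≤ n * (1 + t ^ 2)⁻¹ := by
      rwa [← div_eq_mul_inv, le_div_iff₀ h2]
    exact (min_eq_left (by linarith [neg_abs_le (κ t)])).symm

/-- A summable density that annihilates all translates of bounded holomorphic functions annihilates
the bounded functions of the Smirnov class. -/
theorem integral_smirnov_mul_eq_zero {G F : ℍ → ℂ} (hG : IsHardyInfty G) (hF : IsHardyInfty F)
    (hFo : IsOuter F) {N : ℝ → ℂ} (hN : HasBoundaryFunction (fun z => G z / F z) N)
    (hNb : MemLp N ∞) {w : ℝ → ℂ} (hw : Integrable w)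
    (horth : ∀ M : ℂ → ℂ, DifferentiableOn ℂ M {z | 0 < z.im} →
      (∃ C : ℝ, ∀ z : ℂ, 0 < z.im → ‖M z‖ ≤ C) →
      ∀ δ : ℝ, 0 < δ → ∫ x : ℝ, M (x + δ * Complex.I) * w x = 0) :
    ∫ x, N x * w x = 0 := by
  obtain ⟨c, k, hc, hk, hFk⟩ := hFo
  obtain ⟨hGd, CG, hCG⟩ := hG
  set κ : ℝ → ℝ := fun t => k t / (1 + t ^ 2) with hκ
  have hFexp : ∀ z : ℍ, F z = c * Complex.exp (outerExponent κ z) := hFk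
  have hc0 : c ≠ 0 := norm_pos_iff.1 (by rw [hc]; exact one_pos)
  have hF0 : ∀ z, F z ≠ 0 := fun z => by
    rw [hFexp]
    exact mul_ne_zero hc0 (Complex.exp_ne_zero _)
  set φ : ℂ → ℂ := fun z => G (ofComplex z) / F (ofComplex z) with hφ
  have hφd : DifferentiableOn ℂ φ {z | 0 < z.im} :=
    (UpperHalfPlane.mdifferentiable_iff.1 hGd).div (UpperHalfPlane.mdifferentiable_iff.1 hF.1)
      fun z _ => hF0 _
  -- The outer function of log-modulus min(0, k + n): it is bounded by 1 and small enough where F is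
  -- small for V n · G/F to be bounded.
  set V : ℕ → ℂ → ℂ := fun n z => Complex.exp (outerExponent (truncatedDensity κ n) z) with hV
  have hVd : ∀ n, DifferentiableOn ℂ (V n) {z | 0 < z.im} := fun n =>
    (differentiableOn_outerExponent (integrable_truncatedDensity hk n)).cexp
  have hV1 : ∀ n z, 0 < z.im → ‖V n z‖ ≤ 1 := by
    intro n z hz
    rw [hV, Complex.norm_exp, Real.exp_le_one_iff]
    exact re_outerExponent_le (integrable_truncatedDensity hk n) le_rfl
      (mul_truncatedDensity_le κ n) hz
  have hVφ : ∀ n z, 0 < z.im → ‖V n z * φ z‖ ≤ Real.exp n * CG := by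
    intro n z hz
    have h1 : V n z * φ z = c⁻¹ * Complex.exp (outerExponent (truncatedDensity κ n - κ) z)
        * G (ofComplex z) := by
      rw [outerExponent_sub (integrable_truncatedDensity hk n) hk hz, Complex.exp_sub]
      simp only [hV, hφ, hFexp, UpperHalfPlane.ofComplex_apply_of_im_pos hz]
      field_simp
    rw [h1, norm_mul, norm_mul, norm_inv, hc, inv_one, one_mul, Complex.norm_exp]
    have h2 := re_outerExponent_le ((integrable_truncatedDensity hk n).sub hk)
      (Nat.cast_nonneg n) (mul_truncatedDensity_sub_le κ n) hz
    exact mul_le_mul (Real.exp_le_exp.2 h2) (hCG _) (norm_nonneg _) (Real.exp_nonneg _)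
  have hline : ∀ (x : ℝ) {δ : ℝ}, 0 < δ → 0 < ((x : ℂ) + δ * Complex.I).im :=
    fun x δ hδ => by simpa using hδ
  obtain ⟨CN, hCN⟩ : ∃ CN : ℝ, ∀ᵐ x, ‖N x‖ ≤ CN := by
    refine ⟨(eLpNorm N ∞ volume).toReal, ?_⟩
    filter_upwards [ae_le_eLpNormEssSup (f := N) (μ := volume)] with x hx
    rw [← eLpNorm_exponent_top] at hx
    simpa using ENNReal.toReal_mono hNb.2.ne hx
  have hNw : Integrable fun x => N x * w x := hw.bdd_mul hNb.1 hCN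
  have hVNw : ∀ n {δ : ℝ}, 0 < δ →
      Integrable fun x : ℝ => V n (x + δ * Complex.I) * (N x * w x) := fun n δ hδ =>
    hNw.bdd_mul (continuous_line (hVd n).continuousOn hδ).aestronglyMeasurable
      (Eventually.of_forall fun x => hV1 n _ (hline x hδ))
  have hMw : ∀ n {δ : ℝ}, 0 < δ → Integrable fun x : ℝ =>
      V n (x + δ * Complex.I) * φ (x + δ * Complex.I) * w x := fun n δ hδ =>
    hw.bdd_mul (continuous_line ((hVd n).mul hφd).continuousOn hδ).aestronglyMeasurable
      (Eventually.of_forall fun x => hVφ n _ (hline x hδ))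
  -- The integral with φ in place of N is 0 by `horth`. The difference tends to 0 because φ(x + iδ)
  -- → N(x) while |V n| ≤ 1, whether or not V n has a boundary limit.
  have hsmall : ∀ n, Tendsto (fun δ : ℝ => ∫ x : ℝ, V n (x + δ * Complex.I) * (N x * w x))
      (𝓝[>] 0) (𝓝 0) := by
    intro n
    have h1 : Tendsto (fun δ : ℝ => ∫ x : ℝ, (V n (x + δ * Complex.I) * (N x * w x) -
        V n (x + δ * Complex.I) * φ (x + δ * Complex.I) * w x)) (𝓝[>] 0) (𝓝 (∫ _ : ℝ, (0 : ℂ))) := by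
      refine tendsto_integral_filter_of_dominated_convergence
        (fun x => ‖N x * w x‖ + Real.exp n * CG * ‖w x‖) ?_ ?_
        (hNw.norm.add (hw.norm.const_mul _)) ?_
      · filter_upwards [self_mem_nhdsWithin] with δ hδ using ((hVNw n hδ).sub (hMw n hδ)).1
      · filter_upwards [self_mem_nhdsWithin] with δ hδ
        refine Eventually.of_forall fun x => (norm_sub_le _ _).trans (add_le_add ?_ ?_)
        · rw [norm_mul]
          exact mul_le_of_le_one_left (norm_nonneg _) (hV1 n _ (hline x hδ))
        · rw [norm_mul]
          exact mul_le_mul_of_nonneg_right (hVφ n _ (hline x hδ)) (norm_nonneg _)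
      · filter_upwards [hN] with x hx
        have h2 : Tendsto (fun δ : ℝ => ‖N x - φ (x + δ * Complex.I)‖ * ‖w x‖) (𝓝[>] 0) (𝓝 0) := by
          have := ((tendsto_const_nhds (x := N x)).sub hx.tendsto_vertical).norm.mul_const ‖w x‖
          simpa using this
        refine squeeze_zero_norm' ?_ h2
        filter_upwards [self_mem_nhdsWithin] with δ hδ
        have h3 : V n (x + δ * Complex.I) * (N x * w x) -
            V n (x + δ * Complex.I) * φ (x + δ * Complex.I) * w x =
            V n (x + δ * Complex.I) * ((N x - φ (x + δ * Complex.I)) * w x) := by ring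
        rw [h3, norm_mul, ← norm_mul (N x - _)]
        exact mul_le_of_le_one_left (norm_nonneg _) (hV1 n _ (hline x hδ))
    rw [integral_zero] at h1
    refine h1.congr' ?_
    filter_upwards [self_mem_nhdsWithin] with δ hδ
    rw [integral_sub (hVNw n hδ) (hMw n hδ),
      horth (fun z => V n z * φ z) ((hVd n).mul hφd) ⟨_, hVφ n⟩ δ hδ, sub_zero]
  have hVI : ∀ n, Tendsto (fun δ : ℝ => V n (Complex.I + δ * Complex.I)) (𝓝[>] 0)
      (𝓝 (V n Complex.I)) := by
    intro n
    have h1 : ContinuousAt (V n) Complex.I :=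
      ((hVd n).differentiableAt (isOpen_setOf_im_pos.mem_nhds (by simp))).continuousAt
    refine h1.tendsto.comp ?_
    have h2 : Continuous fun δ : ℝ => Complex.I + δ * Complex.I := by fun_prop
    simpa using (h2.tendsto 0).mono_left nhdsWithin_le_nhds
  -- A diagonal choice: δ n is small enough for the integral to be nearly 0 and for the translate to
  -- keep its value at i nearly unchanged.
  have hchoose : ∀ n : ℕ, ∃ δ : ℝ, 0 < δ ∧
      ‖∫ x : ℝ, V n (x + δ * Complex.I) * (N x * w x)‖ < 1 / ((n : ℝ) + 1) ∧
      ‖V n (Complex.I + δ * Complex.I) - V n Complex.I‖ < 1 / ((n : ℝ) + 1) := by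
    intro n
    have hpos : (0 : ℝ) < 1 / ((n : ℝ) + 1) := by positivity
    have h1 := (hsmall n).eventually (Metric.ball_mem_nhds _ hpos)
    have h2 := (hVI n).eventually (Metric.ball_mem_nhds _ hpos)
    obtain ⟨δ, h3, h4, h5⟩ := (h1.and (h2.and self_mem_nhdsWithin)).exists
    exact ⟨δ, h5, by simpa using h3, by simpa [dist_eq_norm] using h4⟩
  choose δ hδ hδint hδI using hchoose
  set W : ℕ → ℂ → ℂ := fun n z => V n (z + δ n * Complex.I) with hW
  have hWim : ∀ n (z : ℂ), -δ n < z.im → 0 < (z + δ n * Complex.I).im := by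
    intro n z hz
    simp only [Complex.add_im, Complex.mul_im, Complex.ofReal_re, Complex.I_im, Complex.ofReal_im,
      Complex.I_re]
    linarith
  have hWd : ∀ n, DifferentiableOn ℂ (W n) {z | -δ n < z.im} := fun n =>
    (hVd n).comp (by fun_prop) (hWim n)
  have hW1 : ∀ n (z : ℂ), -δ n < z.im → ‖W n z‖ ≤ 1 := fun n z hz => hV1 n _ (hWim n z hz)
  have hWI : Tendsto (fun n => W n Complex.I) atTop (𝓝 1) := by
    have h1 : Tendsto (fun n => V n Complex.I) atTop (𝓝 1) := by
      have h2 := ((tendsto_integral_truncatedDensity hk).const_mul Real.pi⁻¹).ofReal.cexp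
      simpa [hV, outerExponent_I] using h2
    have h3 : Tendsto (fun n => W n Complex.I - V n Complex.I) atTop (𝓝 0) :=
      squeeze_zero_norm (fun n => (hδI n).le) tendsto_one_div_add_atTop_nhds_zero_nat
    simpa using h3.add h1
  have hmean := fun n => integral_norm_one_sub_sq_le (hδ n) (hWd n) (hW1 n)
  have hL1 : Tendsto (fun n => eLpNorm ((fun x : ℝ => ‖1 - W n x‖ ^ 2 * (1 + x ^ 2)⁻¹) - 0) 1 volume)
      atTop (𝓝 0) := by
    have h1 : Tendsto (fun n => ENNReal.ofReal (2 * Real.pi * ‖1 - W n Complex.I‖)) atTop (𝓝 0) := by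
      have h2 := (((tendsto_const_nhds (x := (1 : ℂ))).sub hWI).norm).const_mul (2 * Real.pi)
      simpa using ENNReal.tendsto_ofReal h2
    refine tendsto_of_tendsto_of_tendsto_of_le_of_le tendsto_const_nhds h1 (fun n => zero_le)
      fun n => ?_
    rw [sub_zero, eLpNorm_one_eq_lintegral_enorm,
      ← ofReal_integral_norm_eq_lintegral_enorm (hmean n).1]
    refine ENNReal.ofReal_le_ofReal (le_trans (le_of_eq ?_) (hmean n).2)
    congr 1 with x
    exact Real.norm_of_nonneg (by positivity)
  -- Since W n (i) → 1, the weighted mean of |1 - W n|² tends to 0, so a subsequence of W n tends to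
  -- 1 almost everywhere.
  obtain ⟨ns, hns, hae⟩ := (tendstoInMeasure_of_tendsto_eLpNorm one_ne_zero
    (fun n => (hmean n).1.1) aestronglyMeasurable_zero hL1).exists_seq_tendsto_ae
  have hWae : ∀ᵐ x : ℝ, Tendsto (fun i => W (ns i) x) atTop (𝓝 1) := by
    filter_upwards [hae] with x hx
    have hp : (0 : ℝ) < 1 + x ^ 2 := by positivity
    have h1 : Tendsto (fun i => ‖1 - W (ns i) x‖ ^ 2) atTop (𝓝 0) := by
      have h2 := hx.mul_const (1 + x ^ 2)
      simpa [mul_assoc, inv_mul_cancel₀ hp.ne'] using h2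
    have h3 : Tendsto (fun i => ‖1 - W (ns i) x‖) atTop (𝓝 0) := by
      simpa [Real.sqrt_sq (norm_nonneg _)] using h1.sqrt
    have h4 := (tendsto_const_nhds (x := (1 : ℂ))).sub (tendsto_zero_iff_norm_tendsto_zero.2 h3)
    simpa using h4
  have hlim1 : Tendsto (fun i => ∫ x : ℝ, W (ns i) x * (N x * w x)) atTop
      (𝓝 (∫ x, N x * w x)) := by
    refine tendsto_integral_of_dominated_convergence (fun x => ‖N x * w x‖)
      (fun i => (hVNw (ns i) (hδ (ns i))).1) hNw.norm
      (fun i => Eventually.of_forall fun x => ?_) ?_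
    · rw [norm_mul]
      exact mul_le_of_le_one_left (norm_nonneg _) (hW1 _ _ (by simpa using hδ (ns i)))
    · filter_upwards [hWae] with x hx
      simpa using hx.mul_const (N x * w x)
  have hlim2 : Tendsto (fun i => ∫ x : ℝ, W (ns i) x * (N x * w x)) atTop (𝓝 0) :=
    (squeeze_zero_norm (fun n => (hδint n).le)
      tendsto_one_div_add_atTop_nhds_zero_nat).comp hns.tendsto_atTop
  exact tendsto_nhds_unique hlim1 hlim2

/-! ### Boundary functions and products in the Hardy space -/

theorem HasBoundaryFunction.mul {F G : ℍ → ℂ} {f g : ℝ → ℂ} (hF : HasBoundaryFunction F f)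
    (hG : HasBoundaryFunction G g) : HasBoundaryFunction (F * G) (f * g) := by
  filter_upwards [hF, hG] with x hx hy α hα
  exact (hx α hα).mul (hy α hα)

theorem hasBoundaryFunction_of_continuousAt {M : ℂ → ℂ} (hM : ∀ x : ℝ, ContinuousAt M x) :
    HasBoundaryFunction (fun z => M z) (fun x : ℝ => M x) :=
  Eventually.of_forall fun x _ _ => (hM x).tendsto.comp
    (tendsto_comap.mono_right nhdsWithin_le_nhds)

theorem isHardyInfty_of_differentiableOn {M : ℂ → ℂ} (hM : DifferentiableOn ℂ M {z | 0 < z.im})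
    {C : ℝ} (hC : ∀ z : ℂ, 0 < z.im → ‖M z‖ ≤ C) : IsHardyInfty fun z => M z := by
  refine ⟨UpperHalfPlane.mdifferentiable_iff.2 (hM.congr fun z hz => ?_), C,
    fun z => hC z z.im_pos⟩
  simp [UpperHalfPlane.ofComplex_apply_of_im_pos hz]

theorem IsHardyInfty.mul_mem_hardyTwo {M E : ℍ → ℂ} (hM : IsHardyInfty M) (hE : E ∈ hardyTwo) :
    M * E ∈ hardyTwo := by
  obtain ⟨hMd, B, hB⟩ := hM
  obtain ⟨hEd, C, hC⟩ := hE
  refine ⟨hMd.mul hEd, B.toNNReal * C, fun y hy => ?_⟩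
  refine (eLpNorm_le_mul_eLpNorm_of_ae_le_mul (g := slice E y hy) (c := B)
    (Eventually.of_forall fun x => ?_) 2).trans ?_
  · simp only [slice, Pi.mul_apply, norm_mul]
    exact mul_le_mul_of_nonneg_right (hB _) (norm_nonneg _)
  · rw [ENNReal.coe_mul]
    exact mul_le_mul_right (hC y hy) _

theorem integral_mul_inv_add_I_eq_zero {E : ℍ → ℂ} (hE : E ∈ hardyTwo) {e : L2}
    (hEe : HasBoundaryFunction E e) : ∫ x : ℝ, e x * ((x : ℂ) + Complex.I)⁻¹ = 0 := by
  obtain ⟨hEd, C, hC⟩ := hE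
  refine integral_boundary_div_eq_zero (UpperHalfPlane.mdifferentiable_iff.1 hEd) (C := C)
    (fun y hy => ?_) (Lp.memLp e) (hEe.mono fun x hx => hx.tendsto_vertical)
  have hslice : (fun x : ℝ => (E ∘ ofComplex) (x + y * Complex.I)) = slice E y hy := by
    funext x
    rw [← Complex.mk_eq_add_mul_I, Function.comp_apply,
      UpperHalfPlane.ofComplex_apply_of_im_pos (z := ⟨x, y⟩) hy, slice]
  rw [hslice]
  exact hC y hy

/-! ### Invariance of `q H²` under multiplication by `H^∞` -/

theorem memLp_two_mul {m f : ℝ → ℂ} (hm : MemLp m ∞) (hf : MemLp f 2) :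
    MemLp (fun x => m x * f x) 2 := hf.mul' hm

theorem mul_mem_mulHardyL2 {q M : ℍ → ℂ} (hM : IsHardyInfty M) {m : ℝ → ℂ}
    (hMm : HasBoundaryFunction M m) (hm : MemLp m ∞) {e : L2} (he : e ∈ mulHardyL2 q) :
    (memLp_two_mul hm (Lp.memLp e)).toLp _ ∈ mulHardyL2 q := by
  obtain ⟨_, ⟨E, hE, rfl⟩, hEe⟩ := he
  refine ⟨_, ⟨M * E, hM.mul_mem_hardyTwo hE, rfl⟩, ?_⟩
  have h1 : LinearMap.mulLeft ℂ q (M * E) = M * LinearMap.mulLeft ℂ q E := by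
    simp only [LinearMap.mulLeft_apply]
    ring
  rw [h1]
  exact (hMm.mul hEe).congr (MemLp.coeFn_toLp _).symm

theorem exists_hardyTwo_of_mem_mulHardyL2 {q : ℍ → ℂ} (hq : IsHardyInfty q) {e : L2}
    (he : e ∈ mulHardyL2 q) : ∃ E ∈ hardyTwo, HasBoundaryFunction E e := by
  obtain ⟨_, ⟨E, hE, rfl⟩, hEe⟩ := he
  exact ⟨_, hq.mul_mem_hardyTwo hE, hEe⟩

/-- The translate of a bounded holomorphic function is a multiplier of `q H²`. -/
theorem line_mul_mem_mulHardyL2 {q : ℍ → ℂ} {M : ℂ → ℂ}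
    (hM : DifferentiableOn ℂ M {z | 0 < z.im}) {C : ℝ} (hC : ∀ z : ℂ, 0 < z.im → ‖M z‖ ≤ C)
    {δ : ℝ} (hδ : 0 < δ) {e : L2} (he : e ∈ mulHardyL2 q) :
    ∃ e' ∈ mulHardyL2 q, e' =ᵐ[volume] fun x : ℝ => M (x + δ * Complex.I) * e x := by
  have him : ∀ z : ℂ, -δ < z.im → 0 < (z + δ * Complex.I).im := by
    intro z hz
    simp only [Complex.add_im, Complex.mul_im, Complex.ofReal_re, Complex.I_im, Complex.ofReal_im,
      Complex.I_re]
    linarith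
  have hd : DifferentiableOn ℂ (fun z => M (z + δ * Complex.I)) {z | -δ < z.im} :=
    hM.comp (by fun_prop) him
  have hopen : IsOpen {z : ℂ | -δ < z.im} := isOpen_lt continuous_const Complex.continuous_im
  have hbd : MemLp (fun x : ℝ => M (x + δ * Complex.I)) ∞ :=
    memLp_top_of_bound (continuous_line hM.continuousOn hδ).aestronglyMeasurable C
      (Eventually.of_forall fun x => hC _ (by simpa using hδ))
  refine ⟨_, mul_mem_mulHardyL2 (M := fun z => M (z + δ * Complex.I)) (q := q)
    (isHardyInfty_of_differentiableOn
      (hd.mono fun z (hz : 0 < z.im) => (by linarith : -δ < 0).trans hz)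
      fun z hz => hC _ (him z (by linarith)))
    (hasBoundaryFunction_of_continuousAt fun x =>
      (hd.differentiableAt (hopen.mem_nhds (by simpa using hδ))).continuousAt) hbd he,
    MemLp.coeFn_toLp _⟩

/-! ### The functions `1 / (z + i)` and `(z - i) / (z + i)` -/

theorem differentiableAt_inv_add_I {z : ℂ} (hz : 0 ≤ z.im) :
    DifferentiableAt ℂ (fun z : ℂ => (z + Complex.I)⁻¹) z :=
  DifferentiableAt.inv (by fun_prop) (add_I_ne_zero hz)

theorem norm_inv_add_I_le {z : ℂ} (hz : 0 ≤ z.im) : ‖(z + Complex.I)⁻¹‖ ≤ 1 := by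
  rw [norm_inv]
  refine inv_le_one_of_one_le₀ ?_
  have := (le_abs_self _).trans (Complex.abs_im_le_norm (z + Complex.I))
  simp only [Complex.add_im, Complex.I_im] at this
  linarith

theorem isHardyInfty_inv_add_I : IsHardyInfty fun z => ((z : ℂ) + Complex.I)⁻¹ :=
  isHardyInfty_of_differentiableOn (M := fun z => (z + Complex.I)⁻¹)
    (fun _ hz => (differentiableAt_inv_add_I (le_of_lt hz)).differentiableWithinAt)
    fun _ hz => norm_inv_add_I_le hz.le

theorem hasBoundaryFunction_inv_add_I :
    HasBoundaryFunction (fun z => ((z : ℂ) + Complex.I)⁻¹) fun x : ℝ => ((x : ℂ) + Complex.I)⁻¹ :=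
  hasBoundaryFunction_of_continuousAt (M := fun z => (z + Complex.I)⁻¹)
    fun x => (differentiableAt_inv_add_I (by simp)).continuousAt

theorem memLp_top_inv_add_I : MemLp (fun x : ℝ => ((x : ℂ) + Complex.I)⁻¹) ∞ :=
  memLp_top_of_bound (Continuous.inv₀ (by fun_prop)
    fun x => add_I_ne_zero (by simp)).aestronglyMeasurable 1
    (Eventually.of_forall fun x => norm_inv_add_I_le (by simp))

theorem memLp_two_inv_add_I : MemLp (fun x : ℝ => ((x : ℂ) + Complex.I)⁻¹) 2 := by
  simpa using memLp_inv_add_mul_I one_pos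

theorem inv_add_I_mem_hardyTwo : (fun z : ℍ => ((z : ℂ) + Complex.I)⁻¹) ∈ hardyTwo := by
  refine ⟨isHardyInfty_inv_add_I.1, (1 * √Real.pi).toNNReal, fun y hy => ?_⟩
  have hslice : slice (fun z : ℍ => ((z : ℂ) + Complex.I)⁻¹) y hy
      = fun x : ℝ => ((x : ℂ) + y * Complex.I + Complex.I)⁻¹ := by
    funext x
    rw [← Complex.mk_eq_add_mul_I, slice]
  rw [hslice]
  exact eLpNorm_line_le_of_norm_le (Q := fun z => (z + Complex.I)⁻¹) zero_le_one
    (fun z _ => (one_mul _).ge) hy.le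

theorem isHardyInfty_blaschke :
    IsHardyInfty fun z => ((z : ℂ) - Complex.I) / ((z : ℂ) + Complex.I) := by
  refine isHardyInfty_of_differentiableOn (M := fun z => (z - Complex.I) / (z + Complex.I)) (C := 3)
    (DifferentiableOn.div (by fun_prop) (by fun_prop) fun z hz => add_I_ne_zero (le_of_lt hz))
    fun z hz => ?_
  have h1 : (z - Complex.I) / (z + Complex.I) = 1 - 2 * Complex.I * (z + Complex.I)⁻¹ := by
    have := add_I_ne_zero hz.le
    field_simp
    ring
  rw [h1]
  refine (norm_sub_le _ _).trans ?_
  have := norm_inv_add_I_le hz.le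
  simp only [norm_one, norm_mul, Complex.norm_ofNat, Complex.norm_I]
  linarith

theorem hasBoundaryFunction_blaschke :
    HasBoundaryFunction (fun z => ((z : ℂ) - Complex.I) / ((z : ℂ) + Complex.I)) blaschkeI :=
  hasBoundaryFunction_of_continuousAt (M := fun z => (z - Complex.I) / (z + Complex.I))
    fun x => ContinuousAt.div (by fun_prop) (by fun_prop) (add_I_ne_zero (by simp))

theorem measurable_blaschkeI : Measurable blaschkeI := by
  unfold blaschkeI
  fun_prop

theorem memLp_top_blaschkeI : MemLp blaschkeI ∞ :=
  memLp_top_of_bound measurable_blaschkeI.aestronglyMeasurable 1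
    (Eventually.of_forall fun x => (norm_blaschkeI x).le)

/-- Both sides are 1/(x - i). This identity brings in the factor b for which the Smirnov condition
is assumed. -/
theorem conj_inv_add_I (x : ℝ) :
    conj (((x : ℂ) + Complex.I)⁻¹) = conj (blaschkeI x) * ((x : ℂ) + Complex.I)⁻¹ := by
  have h1 : (x : ℂ) + Complex.I ≠ 0 := add_I_ne_zero (by simp)
  have h2 : (x : ℂ) - Complex.I ≠ 0 := fun h => by simpa using congrArg Complex.im h
  simp only [blaschkeI, map_inv₀, map_div₀, map_add, map_sub, Complex.conj_ofReal, Complex.conj_I,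
    sub_neg_eq_add, ← sub_eq_add_neg]
  field_simp

theorem blaschkeI_injective : Function.Injective blaschkeI := by
  intro x y hxy
  have h1 : (x : ℂ) + Complex.I ≠ 0 := add_I_ne_zero (by simp)
  have h2 : (y : ℂ) + Complex.I ≠ 0 := add_I_ne_zero (by simp)
  simp only [blaschkeI] at hxy
  rw [div_eq_div_iff h1 h2] at hxy
  have h3 : (2 * Complex.I) * ((x : ℂ) - y) = 0 := by linear_combination hxy
  have h4 : (x : ℂ) - y = 0 := by simpa using h3
  exact_mod_cast sub_eq_zero.1 h4

/-! ### Kernels of generalized Toeplitz operators -/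

theorem coeFn_mulOp {φ : ℝ → ℂ} (hφ : MemLp φ ∞) (f : L2) :
    mulOp φ hφ f =ᵐ[volume] fun x => φ x * f x := by
  have h1 := (ContinuousLinearMap.mul ℂ ℂ).coeFn_holder (r := 2) (hφ.toLp φ) f
  filter_upwards [h1, hφ.coeFn_toLp] with x hx hφx
  rw [← hφx]
  exact hx

/-- A subspace and its closure have the same orthogonal complement, so testing against E₂ itself
suffices. -/
theorem mem_toeplitzKernel_iff {E₁ E₂ : Submodule ℂ L2} {φ : ℝ → ℂ} {hφ : MemLp φ ∞ volume}
    {f : L2} : f ∈ toeplitzKernel E₁ E₂ φ hφ ↔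
      f ∈ E₁ ∧ ∀ e ∈ E₂, ∫ x, conj (φ x * f x) * e x = 0 := by
  have hmem : ∀ f : L2, mulOp φ hφ f ∈ E₂.topologicalClosureᗮ ↔
      ∀ e ∈ E₂, ∫ x, conj (φ x * f x) * e x = 0 := by
    intro f
    rw [Submodule.orthogonal_closure, Submodule.mem_orthogonal']
    refine forall₂_congr fun e _ => ?_
    rw [L2.inner_def]
    refine Eq.congr_left (integral_congr_ae ?_)
    filter_upwards [coeFn_mulOp hφ f] with x hx
    rw [hx, RCLike.inner_apply, mul_comm]
  rw [← hmem, ← Submodule.orthogonalProjectionOnto_eq_zero_iff]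
  constructor
  · rintro ⟨f, hf, rfl⟩
    exact ⟨f.2, hf⟩
  · rintro ⟨hf, h⟩
    exact ⟨⟨f, hf⟩, h, rfl⟩

theorem integrable_conj_mul {u v : ℝ → ℂ} (hu : MemLp u 2) (hv : MemLp v 2) :
    Integrable fun x => conj (u x) * v x :=
  memLp_one_iff_integrable.1 (hv.mul' (q := 2) hu.star)

/-- The kernel of the operator with symbol `φ b̄` contains `f` and `b f` whenever `f` is in the
kernel of the operator with symbol `φ`. -/
theorem two_le_rank_toeplitzKernel {q : ℍ → ℂ} {φ : ℝ → ℂ} (hφ : MemLp φ ∞ volume)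
    (hker : toeplitzKernel hardyL2 (mulHardyL2 q) φ hφ ≠ ⊥) :
    2 ≤ Module.rank ℂ (toeplitzKernel hardyL2 (mulHardyL2 q)
      (fun x => φ x * conj (blaschkeI x)) (memLp_mul_conj_blaschkeI hφ)) := by
  obtain ⟨f, hf, hf0⟩ := Submodule.exists_mem_ne_zero_of_ne_bot hker
  obtain ⟨hfH, hfe⟩ := mem_toeplitzKernel_iff.1 hf
  set bf : L2 := (memLp_two_mul memLp_top_blaschkeI (Lp.memLp f)).toLp _ with hbf
  have hbfx : bf =ᵐ[volume] fun x => blaschkeI x * f x := MemLp.coeFn_toLp _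
  have hbb : ∀ x, conj (blaschkeI x) * blaschkeI x = 1 := fun x => by
    rw [mul_comm, Complex.mul_conj, Complex.normSq_eq_norm_sq, norm_blaschkeI]
    norm_num
  -- Pairing φ·conj b·f with e is pairing φf with be, and be stays in qH². For bf below, conj b · b
  -- = 1 removes the factor altogether.
  have h1 : f ∈ toeplitzKernel hardyL2 (mulHardyL2 q)
      (fun x => φ x * conj (blaschkeI x)) (memLp_mul_conj_blaschkeI hφ) := by
    refine mem_toeplitzKernel_iff.2 ⟨hfH, fun e he => ?_⟩
    have := hfe _ (mul_mem_mulHardyL2 isHardyInfty_blaschke hasBoundaryFunction_blaschke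
      memLp_top_blaschkeI he)
    rw [← this]
    refine integral_congr_ae ?_
    filter_upwards [MemLp.coeFn_toLp (memLp_two_mul memLp_top_blaschkeI (Lp.memLp e))] with x hx
    rw [hx]
    simp only [map_mul, Complex.conj_conj]
    ring
  have h2 : bf ∈ toeplitzKernel hardyL2 (mulHardyL2 q)
      (fun x => φ x * conj (blaschkeI x)) (memLp_mul_conj_blaschkeI hφ) := by
    refine mem_toeplitzKernel_iff.2 ⟨?_, fun e he => ?_⟩
    · obtain ⟨F, hF, hFf⟩ := hfH
      exact ⟨_, isHardyInfty_blaschke.mul_mem_hardyTwo hF,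
        (hasBoundaryFunction_blaschke.mul hFf).congr hbfx.symm⟩
    · rw [← hfe e he]
      refine integral_congr_ae ?_
      filter_upwards [hbfx] with x hx
      rw [hx]
      simp only [map_mul, Complex.conj_conj]
      linear_combination (conj (φ x) * conj (f x) * e x) * hbb x
  have hind : LinearIndependent ℂ ![(⟨f, h1⟩ : toeplitzKernel hardyL2 (mulHardyL2 q)
      (fun x => φ x * conj (blaschkeI x)) (memLp_mul_conj_blaschkeI hφ)), ⟨bf, h2⟩] := by
    rw [LinearIndependent.pair_iff]
    intro s t hst
    have hst' : s • f + t • bf = 0 := congrArg Subtype.val hst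
    by_contra hne
    -- As b is injective on ℝ, s + tb has at most one zero there unless s = t = 0, so a relation (s
    -- + tb)f = 0 forces f = 0 almost everywhere.
    have hsub : {x | s + t * blaschkeI x = 0}.Subsingleton := by
      intro x hx y hy
      simp only [Set.mem_ofPred_eq] at hx hy
      by_cases ht : t = 0
      · exact absurd ⟨by simpa [ht] using hx, ht⟩ hne
      · exact blaschkeI_injective (mul_left_cancel₀ ht (by linear_combination hx - hy))
    have hnull : ∀ᵐ x : ℝ, s + t * blaschkeI x ≠ 0 := by
      simpa [ae_iff] using hsub.measure_zero volume
    refine hf0 ((Lp.eq_zero_iff_ae_eq_zero).2 ?_)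
    have h3 := Lp.coeFn_add (s • f) (t • bf)
    rw [hst'] at h3
    filter_upwards [hnull, h3, Lp.coeFn_zero ℂ 2 (volume : Measure ℝ), Lp.coeFn_smul s f,
      Lp.coeFn_smul t bf, hbfx] with x hx h3x h0x h4x h5x h6x
    rw [h0x] at h3x
    simp only [Pi.zero_apply, Pi.add_apply, h4x, h5x, Pi.smul_apply, h6x, smul_eq_mul] at h3x
    have h7 : (s + t * blaschkeI x) * f x = 0 := by linear_combination -h3x
    exact (mul_eq_zero.1 h7).resolve_left hx
  simpa using hind.cardinal_le_rank

/-- If `φ b ∈ conj N⁺`, then `1 / (z + i)` is in the kernel of the operator with symbol `φ`. -/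
theorem inv_add_I_mem_toeplitzKernel {q : ℍ → ℂ} (hq : IsHardyInfty q) {φ : ℝ → ℂ}
    (hφ : MemLp φ ∞ volume) (hs : IsConjSmirnov fun x => φ x * blaschkeI x) :
    memLp_two_inv_add_I.toLp _ ∈ toeplitzKernel hardyL2 (mulHardyL2 q) φ hφ := by
  obtain ⟨G, F, hG, hF, hFo, hN⟩ := hs
  have hNb : MemLp (fun x => conj (φ x * blaschkeI x)) ∞ :=
    (memLp_top_blaschkeI.mul' (r := ∞) hφ).star
  refine mem_toeplitzKernel_iff.2 ⟨⟨_, inv_add_I_mem_hardyTwo,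
    hasBoundaryFunction_inv_add_I.congr (MemLp.coeFn_toLp _).symm⟩, fun e he => ?_⟩
  have hw : Integrable fun x : ℝ => e x * ((x : ℂ) + Complex.I)⁻¹ :=
    memLp_one_iff_integrable.1 (memLp_two_inv_add_I.mul' (q := 2) (Lp.memLp e))
  -- The density is w = e/(x + i), with N = conj(φb). It annihilates translates because M(x + iδ)e
  -- is again in qH² ⊆ H², hence orthogonal to 1/(x - i).
  rw [← integral_smirnov_mul_eq_zero hG hF hFo hN hNb hw]
  · refine integral_congr_ae ?_
    filter_upwards [memLp_two_inv_add_I.coeFn_toLp] with x hx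
    rw [hx]
    simp only [map_mul, conj_inv_add_I]
    ring
  · rintro M hM ⟨C, hC⟩ δ hδ
    obtain ⟨e', he', hee'⟩ := line_mul_mem_mulHardyL2 hM hC hδ he
    obtain ⟨E', hE', hE'e'⟩ := exists_hardyTwo_of_mem_mulHardyL2 hq he'
    rw [← integral_mul_inv_add_I_eq_zero hE' hE'e']
    refine integral_congr_ae ?_
    filter_upwards [hee'] with x hx
    rw [hx, mul_assoc]

/-- If `(h / g) b ∈ conj N⁺`, then `1 / (z + i)` multiplies the kernel of the operator with symbol
`g` into the kernel of the operator with symbol `h`. -/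
theorem inv_add_I_mem_multipliersTwo {q : ℍ → ℂ} {g h : ℝ → ℂ} (hg : MemLp g ∞ volume)
    (hh : MemLp h ∞ volume) (hg_ne : ∀ᵐ x : ℝ, g x ≠ 0)
    (hg_inv : MemLp (fun x => (g x)⁻¹) ∞ volume)
    (hs : IsConjSmirnov fun x => h x / g x * blaschkeI x) :
    (fun z : ℍ => ((z : ℂ) + Complex.I)⁻¹) ∈ multipliersTwo
      (toeplitzKernel hardyL2 (mulHardyL2 q) g hg)
      (toeplitzKernel hardyL2 (mulHardyL2 q) h hh) := by
  obtain ⟨G, F, hG, hF, hFo, hN⟩ := hs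
  have hNb : MemLp (fun x => conj (h x / g x * blaschkeI x)) ∞ :=
    (memLp_top_blaschkeI.mul' (r := ∞) (memLp_div hh hg_inv)).star
  refine ⟨⟨isHardyInfty_inv_add_I.1, ?_⟩, memLp_two_inv_add_I.toLp _,
    hasBoundaryFunction_inv_add_I.congr (MemLp.coeFn_toLp _).symm⟩
  rintro U ⟨hU, u, hu, hUu⟩
  have hψU := isHardyInfty_inv_add_I.mul_mem_hardyTwo hU
  have hψu := (hasBoundaryFunction_inv_add_I.mul hUu).congr
    (MemLp.coeFn_toLp (memLp_two_mul memLp_top_inv_add_I (Lp.memLp u))).symm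
  refine ⟨hψU, _, mem_toeplitzKernel_iff.2 ⟨⟨_, hψU, hψu⟩, fun e he => ?_⟩, hψu⟩
  have hgu : MemLp (fun x => g x * u x) 2 := memLp_two_mul hg (Lp.memLp u)
  have hψe := memLp_two_mul memLp_top_inv_add_I (Lp.memLp e)
  -- The density is w = conj(gu)·ψe, with N = conj(hb/g); g ≠ 0 lets the factors g cancel. It
  -- annihilates translates because M(x + iδ)ψe lies in qH², to which gu is orthogonal.
  rw [← integral_smirnov_mul_eq_zero hG hF hFo hN hNb (integrable_conj_mul hgu hψe)]
  · refine integral_congr_ae ?_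
    filter_upwards [hg_ne, MemLp.coeFn_toLp (memLp_two_mul memLp_top_inv_add_I (Lp.memLp u))]
      with x hgx hx
    have hgx' : conj (g x) ≠ 0 := (map_ne_zero _).2 hgx
    rw [hx]
    simp only [map_mul, map_div₀, conj_inv_add_I]
    field_simp
  · rintro M hM ⟨C, hC⟩ δ hδ
    obtain ⟨e', he', hee'⟩ := line_mul_mem_mulHardyL2 hM hC hδ
      (mul_mem_mulHardyL2 isHardyInfty_inv_add_I hasBoundaryFunction_inv_add_I
        memLp_top_inv_add_I he)
    rw [← (mem_toeplitzKernel_iff.1 hu).2 e' he']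
    refine integral_congr_ae ?_
    filter_upwards [hee', MemLp.coeFn_toLp hψe] with x hx hx'
    rw [hx, hx']
    ring

end HalfPlane

end

/-! ### The equivalence. -/

theorem mainTheorem2
    (q : UpperHalfPlane → ℂ) (hq : HalfPlane.IsInner q)
    (g h : ℝ → ℂ) (hg : MemLp g ∞ volume) (hh : MemLp h ∞ volume)
    (hg_ne : ∀ᵐ x : ℝ, g x ≠ 0) (hg_inv : MemLp (fun x => (g x)⁻¹) ∞ volume)
    (hker_g : HalfPlane.toeplitzKernel HalfPlane.hardyL2 (HalfPlane.mulHardyL2 q) g hg ≠ ⊥)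
    (hker_h : HalfPlane.toeplitzKernel HalfPlane.hardyL2 (HalfPlane.mulHardyL2 q) h hh ≠ ⊥)
    (hsmirnov : HalfPlane.IsConjSmirnov (fun x => h x / g x * HalfPlane.blaschkeI x)) :
    List.TFAE [
      2 ≤ Module.rank ℂ (HalfPlane.toeplitzKernel HalfPlane.hardyL2 (HalfPlane.mulHardyL2 q)
        (fun x => h x / g x * conj (HalfPlane.blaschkeI x))
        (HalfPlane.memLp_mul_conj_blaschkeI (HalfPlane.memLp_div hh hg_inv))),
      HalfPlane.toeplitzKernel HalfPlane.hardyL2 (HalfPlane.mulHardyL2 q)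
        (fun x => h x / g x) (HalfPlane.memLp_div hh hg_inv) ≠ ⊥,
      HalfPlane.multipliersTwo
        (HalfPlane.toeplitzKernel HalfPlane.hardyL2 (HalfPlane.mulHardyL2 q) g hg)
        (HalfPlane.toeplitzKernel HalfPlane.hardyL2 (HalfPlane.mulHardyL2 q) h hh) ≠ ⊥] := by
  have hker : HalfPlane.toeplitzKernel HalfPlane.hardyL2 (HalfPlane.mulHardyL2 q)
      (fun x => h x / g x) (HalfPlane.memLp_div hh hg_inv) ≠ ⊥ := by
    refine Submodule.ne_bot_iff _ |>.2 ⟨_, HalfPlane.inv_add_I_mem_toeplitzKernel hq.1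
      (HalfPlane.memLp_div hh hg_inv) hsmirnov, fun h0 => ?_⟩
    have h1 := (Lp.eq_zero_iff_ae_eq_zero.1 h0).symm.trans HalfPlane.memLp_two_inv_add_I.coeFn_toLp
    obtain ⟨x, hx⟩ := h1.exists
    exact inv_ne_zero (HalfPlane.add_I_ne_zero (z := (x : ℂ)) (by simp)) hx.symm
  have hmul : HalfPlane.multipliersTwo
      (HalfPlane.toeplitzKernel HalfPlane.hardyL2 (HalfPlane.mulHardyL2 q) g hg)
      (HalfPlane.toeplitzKernel HalfPlane.hardyL2 (HalfPlane.mulHardyL2 q) h hh) ≠ ⊥ := by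
    refine Submodule.ne_bot_iff _ |>.2 ⟨_, HalfPlane.inv_add_I_mem_multipliersTwo hg hh hg_ne
      hg_inv hsmirnov, fun h0 => ?_⟩
    exact inv_ne_zero (HalfPlane.add_I_ne_zero UpperHalfPlane.I.im_pos.le)
      (congrFun h0 UpperHalfPlane.I)
  tfae_have 2 → 1 := HalfPlane.two_le_rank_toeplitzKernel _
  tfae_have 1 → 3 := fun _ => hmul
  tfae_have 3 → 2 := fun _ => hker
  tfae_finish
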